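/- Let $\Bbbk$ be an arbitrary commutative ring. A supermodule is a $\mathbb{Z}/2$-graded $\Bbbk$-module $V=V_0\oplus V_1$; put $c(v\otimes w)=(-1)^{|v||w|}\,w\otimes v$ for homogeneous $v,w$. A Lie superalgebra is a supermodule $\mathfrak g=\mathfrak g_0\oplus\mathfrak g_1$ with an even bilinear bracket such that $[u,u]=0$ for $u\in\mathfrak g_0$, $[[v,v],v]=0$ for $v\in\mathfrak g_1$, and, for homogeneous $x,y,z$, $$[x,y]+(-1)^{|x||y|}[y,x]=0,$$ $$[[x,y],z]+(-1)^{|x|(|y|+|z|)}[[y,z],x]+(-1)^{(|x|+|y|)|z|}[[z,x],y]=0.$$ A $2$-operation on $\mathfrak g$ is a map $(\ )^{\langle2\rangle}:\mathfrak g_1\to\mathfrak g_0$ such that $(cv)^{\langle2\rangle}=c^2v^{\langle2\rangle}$, $(v+w)^{\langle2\rangle}=v^{\langle2\rangle}+[v,w]+w^{\langle2\rangle}$ and $[v^{\langle2\rangle},z]=[v,[v,z]]$ for all $c\in\Bbbk$, $v,w\in\mathfrak g_1$, $z\in\mathfrak g$. Let $\mathfrak g$ be a Lie superalgebra with a $2$-operation,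 and let $\mathbf U(\mathfrak g)$ be the quotient of the tensor algebra $\mathbf T(\mathfrak g)$ by the two-sided ideal generated by the elements $zw-(-1)^{|z||w|}wz-[z,w]$ ($z,w\in\mathfrak g$ homogeneous) and $v^2-v^{\langle2\rangle}$ ($v\in\mathfrak g_1$). It is a Hopf superalgebra with the induced grading in which every element of $\mathfrak g$ is primitive. Let $U(\mathfrak g_0)$ be the universal enveloping algebra of the Lie algebra $\mathfrak g_0$, a purely even Hopf superalgebra in which every element of $\mathfrak g_0$ is primitive, and let $\wedge(\mathfrak g_1)$ be the exterior algebra, a Hopf superalgebra in which every element of $\mathfrak g_1$ is an odd primitive. The inclusion $\mathfrak g_0\subset\mathfrak g$ induces an algebra map $U(\mathfrak g_0)\to\mathbf U(\mathfrak g)$, through which $\mathbf U(\mathfrak g)$ is a left $U(\mathfrak g_0)$-module. (1) Suppose that $\mathfrak g_0$ and $\mathfrak g_1$ are $\Bbbk$-free with bases $X_0$ and $X_1$, each given an arbitrary total order. Then the monomials $$a_1^{r_1}\cdots a_m^{r_m}\,x_1\cdots x_n,\qquad a_1<\dots<a_m \text{ in } X_0,\ r_i>0,\ m\ge0,\quad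 x_1<\dots<x_n\text{ in }X_1,\ n\ge0,$$ form a $\Bbbk$-free basis of $\mathbf U(\mathfrak g)$. (2) Suppose that $\mathfrak g_0$ is a finitely generated projective $\Bbbk$-module and that $\mathfrak g_1$ is $\Bbbk$-free. Then there is an isomorphism of left $U(\mathfrak g_0)$-modules and of super-coalgebras (that is, a grading-preserving bijection compatible with the comultiplications and the counits) $$U(\mathfrak g_0)\otimes\wedge(\mathfrak g_1)\ \overset{\simeq}{\longrightarrow}\ \mathbf U(\mathfrak g)$$ that sends $1\otimes1$ to $1$. -/

import Mathlib

open scoped TensorProduct DirectSum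

noncomputable section

/-- A Lie superalgebra over `k`: a `ZMod 2`-graded `k`-module `g = 𝒢 0 ⊕ 𝒢 1` with an even
bilinear super-bracket, subject to the axioms valid over an arbitrary commutative ring. -/
class LieSuperalgebra {k g : Type*} [CommRing k] [AddCommGroup g] [Module k g]
    (𝒢 : ZMod 2 → Submodule k g) [DirectSum.Decomposition 𝒢] where
  /-- the super-bracket -/
  bracket : g →ₗ[k] g →ₗ[k] g
  bracket_mem : ∀ {i j : ZMod 2} {x y : g}, x ∈ 𝒢 i → y ∈ 𝒢 j → bracket x y ∈ 𝒢 (i + j)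
  bracket_self : ∀ {u : g}, u ∈ 𝒢 0 → bracket u u = 0
  bracket_bracket_self : ∀ {v : g}, v ∈ 𝒢 1 → bracket (bracket v v) v = 0
  skew : ∀ {i j : ZMod 2} {x y : g}, x ∈ 𝒢 i → y ∈ 𝒢 j →
    bracket x y + (-1 : ℤˣ) ^ (i * j) • bracket y x = 0
  jacobi : ∀ {i j l : ZMod 2} {x y z : g}, x ∈ 𝒢 i → y ∈ 𝒢 j → z ∈ 𝒢 l →
    bracket (bracket x y) z + (-1 : ℤˣ) ^ (i * (j + l)) • bracket (bracket y z) x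
      + (-1 : ℤˣ) ^ ((i + j) * l) • bracket (bracket z x) y = 0

namespace LieSuperalgebra

section Basic

variable {k g : Type*} [CommRing k] [AddCommGroup g] [Module k g]
  (𝒢 : ZMod 2 → Submodule k g) [DirectSum.Decomposition 𝒢] [LieSuperalgebra 𝒢]

theorem bracket_mem_zero {x y : g} (hx : x ∈ 𝒢 0) (hy : y ∈ 𝒢 0) :
    bracket 𝒢 x y ∈ 𝒢 0 := by
  simpa using bracket_mem (𝒢 := 𝒢) hx hy

theorem leibniz_zero {x y z : g} (hx : x ∈ 𝒢 0) (hy : y ∈ 𝒢 0) (hz : z ∈ 𝒢 0) :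
    bracket 𝒢 x (bracket 𝒢 y z)
      = bracket 𝒢 (bracket 𝒢 x y) z + bracket 𝒢 y (bracket 𝒢 x z) := by
  have h1 := jacobi (𝒢 := 𝒢) hx hy hz
  have h2 := skew (𝒢 := 𝒢) hx (bracket_mem_zero 𝒢 hy hz)
  have h3 := skew (𝒢 := 𝒢) hy (bracket_mem_zero 𝒢 hx hz)
  have h4 := skew (𝒢 := 𝒢) hx hz
  simp only [mul_zero, zero_mul, uzpow_zero, one_smul] at h1 h2 h3 h4
  have h5 : bracket 𝒢 (bracket 𝒢 z x) y = - bracket 𝒢 (bracket 𝒢 x z) y := by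
    rw [eq_neg_of_add_eq_zero_right h4]; simp
  rw [h5] at h1
  rw [eq_neg_of_add_eq_zero_left h2, eq_neg_of_add_eq_zero_left h3]
  rw [← sub_eq_zero, ← neg_eq_zero, ← h1]
  abel

/-- The even part of a Lie superalgebra is a Lie ring under the restricted bracket. -/
instance instLieRingEven : LieRing (𝒢 0) where
  bracket x y := ⟨bracket 𝒢 x y, bracket_mem_zero 𝒢 x.2 y.2⟩
  add_lie x y z := Subtype.ext (by simp)
  lie_add x y z := Subtype.ext (by simp)
  lie_self x := Subtype.ext (bracket_self x.2)
  leibniz_lie x y z := Subtype.ext (leibniz_zero 𝒢 x.2 y.2 z.2)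

/-- The even part of a Lie superalgebra is a Lie algebra under the restricted bracket. -/
instance instLieAlgebraEven : LieAlgebra k (𝒢 0) where
  lie_smul t x y := Subtype.ext
    (by change bracket 𝒢 (x : g) (t • (y : g)) = t • bracket 𝒢 (x : g) (y : g); simp)

theorem coe_lie_even (x y : 𝒢 0) : ((⁅x, y⁆ : 𝒢 0) : g) = bracket 𝒢 (x : g) (y : g) := rfl

end Basic

/-- A `2`-operation on a Lie superalgebra: a map `v ↦ v^⟨2⟩` from the odd to the even part. -/
structure TwoOperation {k g : Type*} [CommRing k] [AddCommGroup g] [Module k g]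
    (𝒢 : ZMod 2 → Submodule k g) [DirectSum.Decomposition 𝒢] [LieSuperalgebra 𝒢] where
  /-- the map `v ↦ v^⟨2⟩` -/
  toFun : 𝒢 1 → 𝒢 0
  map_smul : ∀ (c : k) (v : 𝒢 1), toFun (c • v) = c ^ 2 • toFun v
  map_add : ∀ v w : 𝒢 1,
    (toFun (v + w) : g) = (toFun v : g) + bracket 𝒢 (v : g) (w : g) + (toFun w : g)
  bracket_eq : ∀ (v : 𝒢 1) (z : g),
    bracket 𝒢 (toFun v : g) z = bracket 𝒢 (v : g) (bracket 𝒢 (v : g) z)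

end LieSuperalgebra

open LieSuperalgebra

section Enveloping

variable {k g : Type*} [CommRing k] [AddCommGroup g] [Module k g]
  {𝒢 : ZMod 2 → Submodule k g} [DirectSum.Decomposition 𝒢] [LieSuperalgebra 𝒢]

/-- The defining relations of the universal envelope `𝐔(g)`: the elements
`z w - (-1)^(|z||w|) w z - [z, w]` (`z`, `w` homogeneous) and `v² - v^⟨2⟩` (`v` odd) of the tensor
algebra are set to zero. -/
inductive SuperEnveloping.Rel (q : TwoOperation 𝒢) :
    TensorAlgebra k g → TensorAlgebra k g → Prop
  | bracket {i j : ZMod 2} {z w : g} (hz : z ∈ 𝒢 i) (hw : w ∈ 𝒢 j) :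
      SuperEnveloping.Rel q
        (TensorAlgebra.ι k z * TensorAlgebra.ι k w
          - (-1 : ℤˣ) ^ (i * j) • (TensorAlgebra.ι k w * TensorAlgebra.ι k z)
          - TensorAlgebra.ι k (bracket 𝒢 z w)) 0
  | square (v : 𝒢 1) :
      SuperEnveloping.Rel q
        (TensorAlgebra.ι k (v : g) * TensorAlgebra.ι k (v : g)
          - TensorAlgebra.ι k (q.toFun v : g)) 0

/-- The universal envelope `𝐔(g)` of a Lie superalgebra with a `2`-operation `q`, the quotient of
the tensor algebra by the two-sided ideal generated by the defining relations. -/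
def SuperEnveloping (q : TwoOperation 𝒢) : Type _ := RingQuot (SuperEnveloping.Rel q)

namespace SuperEnveloping

variable (q : TwoOperation 𝒢)

instance instRing : Ring (SuperEnveloping q) :=
  inferInstanceAs (Ring (RingQuot (Rel q)))

instance instAlgebra : Algebra k (SuperEnveloping q) :=
  inferInstanceAs (Algebra k (RingQuot (Rel q)))

/-- The quotient map from the tensor algebra. -/
def mk : TensorAlgebra k g →ₐ[k] SuperEnveloping q := RingQuot.mkAlgHom k (Rel q)

/-- The canonical map `g → 𝐔(g)`. -/
def ι : g →ₗ[k] SuperEnveloping q := (mk q).toLinearMap ∘ₗ TensorAlgebra.ι k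

theorem mk_ι (z : g) : mk q (TensorAlgebra.ι k z) = ι q z := rfl

theorem ι_mul_ι {i j : ZMod 2} {z w : g} (hz : z ∈ 𝒢 i) (hw : w ∈ 𝒢 j) :
    ι q z * ι q w - (-1 : ℤˣ) ^ (i * j) • (ι q w * ι q z) - ι q (bracket 𝒢 z w) = 0 := by
  have h := RingQuot.mkAlgHom_rel k (Rel.bracket (q := q) hz hw)
  change mk q _ = mk q _ at h
  simpa only [map_sub, map_mul, map_zero, Units.smul_def, map_zsmul, mk_ι] using h

theorem ι_sq (v : 𝒢 1) : ι q (v : g) * ι q (v : g) - ι q (q.toFun v : g) = 0 := by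
  have h := RingQuot.mkAlgHom_rel k (Rel.square (q := q) v)
  change mk q _ = mk q _ at h
  simpa only [map_sub, map_mul, map_zero, mk_ι] using h

/-- The universal property of `𝐔(g)`. -/
def lift {A : Type*} [Ring A] [Algebra k A] (f : g →ₗ[k] A)
    (hbr : ∀ {i j : ZMod 2} {z w : g}, z ∈ 𝒢 i → w ∈ 𝒢 j →
      f z * f w - (-1 : ℤˣ) ^ (i * j) • (f w * f z) - f (bracket 𝒢 z w) = 0)
    (hsq : ∀ v : 𝒢 1, f (v : g) * f (v : g) - f (q.toFun v : g) = 0) :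
    SuperEnveloping q →ₐ[k] A :=
  RingQuot.liftAlgHom k ⟨TensorAlgebra.lift k f, by
    intro x y h
    induction h with
    | bracket hz hw =>
      simpa only [map_sub, map_mul, map_zero, Units.smul_def, map_zsmul,
        TensorAlgebra.lift_ι_apply] using hbr hz hw
    | square v =>
      simpa only [map_sub, map_mul, map_zero, TensorAlgebra.lift_ι_apply] using hsq v⟩

@[simp]
theorem lift_ι {A : Type*} [Ring A] [Algebra k A] (f : g →ₗ[k] A)
    (hbr : ∀ {i j : ZMod 2} {z w : g}, z ∈ 𝒢 i → w ∈ 𝒢 j →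
      f z * f w - (-1 : ℤˣ) ^ (i * j) • (f w * f z) - f (bracket 𝒢 z w) = 0)
    (hsq : ∀ v : 𝒢 1, f (v : g) * f (v : g) - f (q.toFun v : g) = 0) (z : g) :
    lift q f hbr hsq (ι q z) = f z := by
  have := RingQuot.liftAlgHom_mkAlgHom_apply k (s := Rel q) (TensorAlgebra.lift k f)
    (by
      intro x y h
      induction h with
      | bracket hz hw =>
        simpa only [map_sub, map_mul, map_zero, Units.smul_def, map_zsmul,
          TensorAlgebra.lift_ι_apply] using hbr hz hw
      | square v =>
        simpa only [map_sub, map_mul, map_zero, TensorAlgebra.lift_ι_apply] using hsq v)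
    (TensorAlgebra.ι k z)
  rw [TensorAlgebra.lift_ι_apply] at this
  exact this

theorem algHom_ext {A : Type*} [Ring A] [Algebra k A] {f f' : SuperEnveloping q →ₐ[k] A}
    (h : ∀ z, f (ι q z) = f' (ι q z)) : f = f' := by
  refine RingQuot.ringQuot_ext' (S := k) (s := Rel q) f f' ?_
  refine TensorAlgebra.hom_ext (LinearMap.ext fun z => ?_)
  exact h z

/-- The product in `𝐔(g)` of a list of homogeneous elements of `g`. -/
def listProd (l : List (Σ j : ZMod 2, 𝒢 j)) : SuperEnveloping q :=
  (l.map fun p => ι q (p.2 : g)).prod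

/-- The `ZMod 2`-grading on `𝐔(g)` induced by that of the tensor algebra: the component of degree
`i` is spanned by the products of homogeneous elements of `g` whose degrees add up to `i`. -/
def grading (i : ZMod 2) : Submodule k (SuperEnveloping q) :=
  Submodule.span k {u | ∃ l : List (Σ j : ZMod 2, 𝒢 j), (l.map Sigma.fst).sum = i ∧ listProd q l = u}

theorem ι_mem_grading {i : ZMod 2} {z : g} (hz : z ∈ 𝒢 i) : ι q z ∈ grading q i :=
  Submodule.subset_span ⟨[⟨i, ⟨z, hz⟩⟩], by simp, by simp [listProd]⟩

instance instGradedMonoid : SetLike.GradedMonoid (grading q) where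
  one_mem := Submodule.subset_span ⟨[], by simp, by simp [listProd]⟩
  mul_mem i j x y hx hy := by
    have h : grading q i * grading q j ≤ grading q (i + j) := by
      rw [grading, grading, Submodule.span_mul_span, Submodule.span_le]
      rintro _ ⟨_, ⟨l, rfl, rfl⟩, _, ⟨l', rfl, rfl⟩, rfl⟩
      exact Submodule.subset_span ⟨l ++ l', by simp, by simp [listProd]⟩
    exact h (Submodule.mul_mem_mul hx hy)

/-- The canonical map from `g` to the direct sum of the components of `𝐔(g)`. -/
def gradedι : g →ₗ[k] ⨁ i, grading q i :=
  DirectSum.toModule k (ZMod 2) (⨁ i, grading q i)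
      (fun i => DirectSum.lof k (ZMod 2) (fun i => grading q i) i ∘ₗ
        ((ι q).restrict (p := 𝒢 i) (q := grading q i) fun _ hz => ι_mem_grading q hz))
    ∘ₗ (DirectSum.decomposeLinearEquiv 𝒢).toLinearMap

theorem gradedι_of_mem {i : ZMod 2} {z : g} (hz : z ∈ 𝒢 i) :
    gradedι q z = DirectSum.of (fun i => grading q i) i ⟨ι q z, ι_mem_grading q hz⟩ := by
  simp only [gradedι, LinearMap.comp_apply, LinearEquiv.coe_coe,
    DirectSum.decomposeLinearEquiv_apply]
  rw [DirectSum.decompose_of_mem _ hz, ← DirectSum.lof_eq_of k, DirectSum.toModule_lof]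
  rfl

theorem gradedι_bracket {i j : ZMod 2} {z w : g} (hz : z ∈ 𝒢 i) (hw : w ∈ 𝒢 j) :
    gradedι q z * gradedι q w - (-1 : ℤˣ) ^ (i * j) • (gradedι q w * gradedι q z)
      - gradedι q (bracket 𝒢 z w) = 0 := by
  have hwz : ι q w * ι q z ∈ grading q (i + j) := by
    rw [add_comm]
    exact SetLike.GradedMul.mul_mem (ι_mem_grading q hw) (ι_mem_grading q hz)
  have h1 : gradedι q w * gradedι q z
      = DirectSum.of (fun i => grading q i) (i + j) ⟨ι q w * ι q z, hwz⟩ := by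
    rw [gradedι_of_mem q hz, gradedι_of_mem q hw, DirectSum.of_mul_of]
    exact DirectSum.of_eq_of_gradedMonoid_eq (Sigma.subtype_ext (add_comm _ _) rfl)
  rw [h1, gradedι_of_mem q (bracket_mem hz hw), gradedι_of_mem q hz, gradedι_of_mem q hw,
    DirectSum.of_mul_of]
  have h := ι_mul_ι q hz hw
  rw [Units.smul_def] at h
  have hsub : ∀ a b : grading q (i + j),
      DirectSum.of (fun i => grading q i) (i + j) a - DirectSum.of (fun i => grading q i) (i + j) b
        = DirectSum.of (fun i => grading q i) (i + j) (a - b) :=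
    fun a b => (map_sub (DirectSum.of (fun i => grading q i) (i + j)) a b).symm
  have hsmul : ∀ (s : ℤˣ) (a : grading q (i + j)),
      s • DirectSum.of (fun i => grading q i) (i + j) a
        = DirectSum.of (fun i => grading q i) (i + j) ((s : ℤ) • a) :=
    fun s a => (map_zsmul (DirectSum.of (fun i => grading q i) (i + j)) (s : ℤ) a).symm
  rw [hsmul, hsub, hsub]
  exact (congrArg _ (Subtype.ext h)).trans (map_zero _)

theorem gradedι_sq (v : 𝒢 1) :
    gradedι q (v : g) * gradedι q (v : g) - gradedι q (q.toFun v : g) = 0 := by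
  rw [gradedι_of_mem q v.2, gradedι_of_mem q (q.toFun v).2, DirectSum.of_mul_of, sub_eq_zero]
  exact DirectSum.of_eq_of_gradedMonoid_eq
    (Sigma.subtype_ext (by decide : (1 + 1 : ZMod 2) = 0) (sub_eq_zero.1 (ι_sq q v)))

/-- The algebra map from `𝐔(g)` to the direct sum of its components. -/
def gradedLift : SuperEnveloping q →ₐ[k] ⨁ i, grading q i :=
  lift (A := ⨁ i, grading q i) q (gradedι q) (gradedι_bracket q) (gradedι_sq q)

theorem gradedLift_listProd (l : List (Σ j : ZMod 2, 𝒢 j))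
    (h : listProd q l ∈ grading q (l.map Sigma.fst).sum) :
    gradedLift q (listProd q l)
      = DirectSum.of (fun i => grading q i) (l.map Sigma.fst).sum ⟨listProd q l, h⟩ := by
  induction l with
  | nil => exact map_one _
  | cons p l ih =>
    have hl : listProd q l ∈ grading q (l.map Sigma.fst).sum :=
      Submodule.subset_span ⟨l, rfl, rfl⟩
    have e : listProd q (p :: l) = ι q (p.2 : g) * listProd q l := by simp [listProd]
    have e1 : gradedLift q (ι q (p.2 : g)) = gradedι q (p.2 : g) := lift_ι q _ _ _ _
    have e2 : gradedLift q (listProd q (p :: l))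
        = gradedLift q (ι q (p.2 : g)) * gradedLift q (listProd q l) := by rw [e, map_mul]
    rw [e2, ih hl, e1, gradedι_of_mem q p.2.2, DirectSum.of_mul_of]
    exact DirectSum.of_eq_of_gradedMonoid_eq (Sigma.subtype_ext
      (show p.1 + (l.map Sigma.fst).sum = ((p :: l).map Sigma.fst).sum from by simp) e.symm)

/-- `𝐔(g)` is a superalgebra. -/
instance instGradedAlgebra : GradedAlgebra (grading q) :=
  GradedAlgebra.ofAlgHom (grading q) (gradedLift q)
    (by
      refine algHom_ext q fun z => ?_
      have e1 : gradedLift q (ι q z) = gradedι q z := lift_ι q _ _ _ _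
      rw [AlgHom.comp_apply, e1, AlgHom.id_apply]
      clear e1
      induction z using DirectSum.Decomposition.inductionOn 𝒢 with
      | zero => simp
      | homogeneous m => rw [gradedι_of_mem q m.2, DirectSum.coeAlgHom_of]
      | add a b ha hb => rw [map_add, map_add, map_add, ha, hb])
    (by
      rintro i ⟨x, hx⟩
      induction hx using Submodule.span_induction with
      | mem x hx =>
        obtain ⟨l, rfl, rfl⟩ := hx
        exact gradedLift_listProd q l _
      | zero => exact (map_zero _).trans (map_zero _).symm
      | add x y hx hy ihx ihy =>
        change gradedLift q (x + y) = _
        rw [map_add]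
        exact (congrArg₂ (· + ·) ihx ihy).trans (map_add _ _ _).symm
      | smul c x hx ih =>
        change gradedLift q (c • x) = _
        rw [map_smul]
        refine (congrArg (c • ·) ih).trans ?_
        rw [← DirectSum.lof_eq_of k, ← DirectSum.lof_eq_of k, ← map_smul]
        rfl)

/-- The map `z ↦ z ⊗ 1 + 1 ⊗ z` from `g` to the super tensor product `𝐔(g) ⊗ 𝐔(g)`. -/
def primitive : g →ₗ[k] grading q ᵍ⊗[k] grading q :=
  (GradedTensorProduct.includeLeft (grading q) (grading q)).toLinearMap ∘ₗ ι q
    + (GradedTensorProduct.includeRight (grading q) (grading q)).toLinearMap ∘ₗ ι q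

theorem primitive_mul {i j : ZMod 2} {z w : g} (hz : z ∈ 𝒢 i) (hw : w ∈ 𝒢 j) :
    primitive q z * primitive q w
      = (ι q z * ι q w) ᵍ⊗ₜ[k] (1 : SuperEnveloping q) + ι q z ᵍ⊗ₜ[k] ι q w
        + (-1 : ℤˣ) ^ (i * j) • (ι q w ᵍ⊗ₜ[k] ι q z)
        + (1 : SuperEnveloping q) ᵍ⊗ₜ[k] (ι q z * ι q w) := by
  have h1 := GradedTensorProduct.tmul_one_mul_coe_tmul (R := k) (grading q) (grading q)
    (ι q z) ⟨_, ι_mem_grading q hw⟩ 1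
  have h2 := GradedTensorProduct.tmul_one_mul_one_tmul (R := k) (grading q) (grading q)
    (ι q z) (ι q w)
  have h3 := GradedTensorProduct.tmul_coe_mul_coe_tmul (R := k) (grading q) (grading q)
    1 ⟨_, ι_mem_grading q hz⟩ ⟨_, ι_mem_grading q hw⟩ 1
  have h4 := GradedTensorProduct.tmul_coe_mul_one_tmul (R := k) (grading q) (grading q)
    1 ⟨_, ι_mem_grading q hz⟩ (ι q w)
  simp only [one_mul, mul_one] at h1 h2 h3 h4
  simp only [primitive, LinearMap.add_apply, LinearMap.comp_apply, AlgHom.toLinearMap_apply,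
    GradedTensorProduct.includeLeft_apply, GradedTensorProduct.includeRight_apply,
    add_mul, mul_add]
  rw [h1, h2, h3, h4]
  abel

theorem primitive_bracket {i j : ZMod 2} {z w : g} (hz : z ∈ 𝒢 i) (hw : w ∈ 𝒢 j) :
    primitive q z * primitive q w - (-1 : ℤˣ) ^ (i * j) • (primitive q w * primitive q z)
      - primitive q (bracket 𝒢 z w) = 0 := by
  have h := (sub_eq_zero.1 (ι_mul_ι q hz hw)).symm
  have hp : primitive q (bracket 𝒢 z w)
      = ι q (bracket 𝒢 z w) ᵍ⊗ₜ[k] (1 : SuperEnveloping q)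
        + (1 : SuperEnveloping q) ᵍ⊗ₜ[k] ι q (bracket 𝒢 z w) := rfl
  rw [primitive_mul q hz hw, primitive_mul q hw hz, mul_comm j i, hp, h]
  rcases Int.units_eq_one_or ((-1 : ℤˣ) ^ (i * j)) with e | e
  · have hl := map_sub (GradedTensorProduct.includeLeft (R := k) (grading q) (grading q))
      (ι q z * ι q w) (ι q w * ι q z)
    have hr := map_sub (GradedTensorProduct.includeRight (R := k) (grading q) (grading q))
      (ι q z * ι q w) (ι q w * ι q z)
    simp only [GradedTensorProduct.includeLeft_apply,
      GradedTensorProduct.includeRight_apply] at hl hr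
    simp only [e, one_smul]
    rw [hl, hr]
    abel
  · have hl := map_add (GradedTensorProduct.includeLeft (R := k) (grading q) (grading q))
      (ι q z * ι q w) (ι q w * ι q z)
    have hr := map_add (GradedTensorProduct.includeRight (R := k) (grading q) (grading q))
      (ι q z * ι q w) (ι q w * ι q z)
    simp only [GradedTensorProduct.includeLeft_apply,
      GradedTensorProduct.includeRight_apply] at hl hr
    simp only [e, Units.neg_smul, one_smul, sub_neg_eq_add]
    rw [hl, hr]
    abel

theorem primitive_sq (v : 𝒢 1) :
    primitive q (v : g) * primitive q (v : g) - primitive q (q.toFun v : g) = 0 := by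
  have h := (sub_eq_zero.1 (ι_sq q v)).symm
  have hp : primitive q (q.toFun v : g)
      = ι q (q.toFun v : g) ᵍ⊗ₜ[k] (1 : SuperEnveloping q)
        + (1 : SuperEnveloping q) ᵍ⊗ₜ[k] ι q (q.toFun v : g) := rfl
  rw [primitive_mul q v.2 v.2, hp, h, mul_one, uzpow_one, Units.neg_smul, one_smul]
  abel

/-- The comultiplication of `𝐔(g)` as a superalgebra map: every element of `g` is primitive. -/
def comulAlgHom : SuperEnveloping q →ₐ[k] grading q ᵍ⊗[k] grading q :=
  lift q (primitive q) (primitive_bracket q) (primitive_sq q)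

/-- The comultiplication of `𝐔(g)`. -/
def comul : SuperEnveloping q →ₗ[k] SuperEnveloping q ⊗[k] SuperEnveloping q :=
  (GradedTensorProduct.of k (grading q) (grading q)).symm.toLinearMap ∘ₗ
    (comulAlgHom q).toLinearMap

/-- The counit of `𝐔(g)`: the algebra map that vanishes on `g`. -/
def counit : SuperEnveloping q →ₐ[k] k :=
  lift q 0 (fun _ _ => by simp) (fun _ => by simp)

end SuperEnveloping

section EvenPart

attribute [local instance 100] LieRing.ofAssociativeRing

variable (q : TwoOperation 𝒢)

/-- The Lie algebra map `g₀ → 𝐔(g)` given by the inclusion `g₀ ⊆ g`. -/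
def evenLieHom : 𝒢 0 →ₗ⁅k⁆ SuperEnveloping q where
  toLinearMap := SuperEnveloping.ι q ∘ₗ (𝒢 0).subtype
  map_lie' {x y} := by
    have h := SuperEnveloping.ι_mul_ι q x.2 y.2
    rw [mul_zero, uzpow_zero, one_smul, sub_eq_zero] at h
    rw [LieRing.of_associative_ring_bracket]
    exact h.symm

/-- The canonical algebra map `U(g₀) → 𝐔(g)`, through which `𝐔(g)` is a left `U(g₀)`-module. -/
def evenMap : UniversalEnvelopingAlgebra k (𝒢 0) →ₐ[k] SuperEnveloping q :=
  UniversalEnvelopingAlgebra.lift k (evenLieHom q)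

end EvenPart

end Enveloping

section Classical

attribute [local instance 100] LieRing.ofAssociativeRing

variable (k L : Type*) [CommRing k] [LieRing L] [LieAlgebra k L]

/-- The Lie algebra map `x ↦ x ⊗ 1 + 1 ⊗ x` from `L` to `U(L) ⊗ U(L)`. -/
def envelopingPrimitive :
    L →ₗ⁅k⁆ UniversalEnvelopingAlgebra k L ⊗[k] UniversalEnvelopingAlgebra k L where
  toFun x := UniversalEnvelopingAlgebra.ι k x ⊗ₜ 1 + 1 ⊗ₜ UniversalEnvelopingAlgebra.ι k x
  map_add' x y := by
    rw [map_add, TensorProduct.add_tmul, TensorProduct.tmul_add]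
    abel
  map_smul' c x := by
    simp [TensorProduct.smul_tmul', TensorProduct.tmul_smul]
  map_lie' {x y} := by
    simp only [LieHom.map_lie, LieRing.of_associative_ring_bracket, add_mul, mul_add,
      Algebra.TensorProduct.tmul_mul_tmul, one_mul, mul_one, TensorProduct.sub_tmul,
      TensorProduct.tmul_sub]
    abel

/-- The comultiplication of the universal envelope `U(L)` of a Lie algebra: the algebra map for
which every element of `L` is primitive. -/
def envelopingComul : UniversalEnvelopingAlgebra k L →ₐ[k]
    UniversalEnvelopingAlgebra k L ⊗[k] UniversalEnvelopingAlgebra k L :=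
  UniversalEnvelopingAlgebra.lift k (envelopingPrimitive k L)

/-- The counit of `U(L)`: the algebra map that vanishes on `L`. -/
def envelopingCounit : UniversalEnvelopingAlgebra k L →ₐ[k] k :=
  UniversalEnvelopingAlgebra.lift k 0

end Classical

section Exterior

variable (k V : Type*) [CommRing k] [AddCommGroup V] [Module k V]

/-- The grading of `⋀ V` as a superalgebra, the elements of `V` being odd. -/
abbrev exteriorGrading : ZMod 2 → Submodule k (ExteriorAlgebra k V) :=
  CliffordAlgebra.evenOdd (0 : QuadraticForm k V)

/-- The map `v ↦ v ⊗ 1 + 1 ⊗ v` from `V` to the super tensor product `⋀ V ⊗ ⋀ V`. -/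
def exteriorPrimitive : V →ₗ[k] exteriorGrading k V ᵍ⊗[k] exteriorGrading k V :=
  (GradedTensorProduct.includeLeft (exteriorGrading k V) (exteriorGrading k V)).toLinearMap
      ∘ₗ ExteriorAlgebra.ι k
    + (GradedTensorProduct.includeRight (exteriorGrading k V) (exteriorGrading k V)).toLinearMap
      ∘ₗ ExteriorAlgebra.ι k

theorem exteriorPrimitive_sq (v : V) : exteriorPrimitive k V v * exteriorPrimitive k V v = 0 := by
  have hv : ExteriorAlgebra.ι k v ∈ exteriorGrading k V 1 :=
    CliffordAlgebra.ι_mem_evenOdd_one _ v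
  have h1 := GradedTensorProduct.tmul_one_mul_coe_tmul (R := k)
    (exteriorGrading k V) (exteriorGrading k V) (ExteriorAlgebra.ι k v) ⟨_, hv⟩ 1
  have h2 := GradedTensorProduct.tmul_one_mul_one_tmul (R := k)
    (exteriorGrading k V) (exteriorGrading k V) (ExteriorAlgebra.ι k v) (ExteriorAlgebra.ι k v)
  have h3 := GradedTensorProduct.tmul_coe_mul_coe_tmul (R := k)
    (exteriorGrading k V) (exteriorGrading k V) 1 ⟨_, hv⟩ ⟨_, hv⟩ 1
  have h4 := GradedTensorProduct.tmul_coe_mul_one_tmul (R := k)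
    (exteriorGrading k V) (exteriorGrading k V) 1 ⟨_, hv⟩ (ExteriorAlgebra.ι k v)
  simp only [one_mul, mul_one, ExteriorAlgebra.ι_sq_zero, uzpow_one, Units.neg_smul,
    one_smul] at h1 h2 h3 h4
  simp only [exteriorPrimitive, LinearMap.add_apply, LinearMap.comp_apply,
    AlgHom.toLinearMap_apply, GradedTensorProduct.includeLeft_apply,
    GradedTensorProduct.includeRight_apply, add_mul, mul_add]
  have hl := map_zero
    (GradedTensorProduct.includeLeft (R := k) (exteriorGrading k V) (exteriorGrading k V))
  have hr := map_zero
    (GradedTensorProduct.includeRight (R := k) (exteriorGrading k V) (exteriorGrading k V))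
  simp only [GradedTensorProduct.includeLeft_apply,
    GradedTensorProduct.includeRight_apply] at hl hr
  rw [h1, h2, h3, h4, hl, hr]
  abel

/-- The comultiplication of `⋀ V` as a superalgebra map: every element of `V` is primitive. -/
def exteriorComulAlgHom :
    ExteriorAlgebra k V →ₐ[k] exteriorGrading k V ᵍ⊗[k] exteriorGrading k V :=
  ExteriorAlgebra.lift k ⟨exteriorPrimitive k V, exteriorPrimitive_sq k V⟩

/-- The comultiplication of `⋀ V`. -/
def exteriorComul : ExteriorAlgebra k V →ₗ[k] ExteriorAlgebra k V ⊗[k] ExteriorAlgebra k V :=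
  (GradedTensorProduct.of k (exteriorGrading k V) (exteriorGrading k V)).symm.toLinearMap ∘ₗ
    (exteriorComulAlgHom k V).toLinearMap

/-- The counit of `⋀ V`: the algebra map that vanishes on `V`. -/
def exteriorCounit : ExteriorAlgebra k V →ₐ[k] k :=
  ExteriorAlgebra.lift k ⟨0, fun _ => by simp⟩

end Exterior

section SuperTensor

variable {k A B : Type*} [CommRing k] [AddCommGroup A] [Module k A] [AddCommGroup B] [Module k B]

/-- The grading of a module regarded as a purely even supermodule. -/
def pureEven (k A : Type*) [CommRing k] [AddCommGroup A] [Module k A] (i : ZMod 2) :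
    Submodule k A :=
  if i = 0 then ⊤ else ⊥

instance instDecompositionPureEven : DirectSum.Decomposition (pureEven k A) where
  decompose' a := DirectSum.of (fun i => pureEven k A i) 0 ⟨a, by simp [pureEven]⟩
  left_inv a := by simp
  right_inv x := by
    induction x using DirectSum.induction_on with
    | zero =>
      rw [map_zero]
      exact map_zero (DirectSum.of (fun i => pureEven k A i) 0)
    | of i x =>
      rw [DirectSum.coeAddMonoidHom_of]
      obtain ⟨x, hx⟩ := x
      by_cases hi : i = 0
      · subst hi; rfl
      · have h0 : x = 0 := by simpa [pureEven, hi] using hx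
        subst h0
        exact (map_zero _).trans (map_zero _).symm
    | add x y hx hy =>
      rw [map_add]
      refine Eq.trans ?_ (congrArg₂ (· + ·) hx hy)
      exact map_add (DirectSum.of (fun i => pureEven k A i) 0) ⟨_, _⟩ ⟨_, _⟩

/-- The grading on the tensor product of two supermodules:
`(A ⊗ B)_i = ⨁_(j + l = i) A_j ⊗ B_l`. -/
def tensorGrading (𝒜 : ZMod 2 → Submodule k A) (ℬ : ZMod 2 → Submodule k B) (i : ZMod 2) :
    Submodule k (A ⊗[k] B) :=
  ⨆ (j : ZMod 2) (l : ZMod 2) (_ : j + l = i), LinearMap.range (TensorProduct.mapIncl (𝒜 j) (ℬ l))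

variable (𝒜 : ZMod 2 → Submodule k A) (ℬ : ZMod 2 → Submodule k B)
  [DirectSum.Decomposition 𝒜] [DirectSum.Decomposition ℬ]

/-- The super-symmetry `a ⊗ b ↦ (-1)^(|a||b|) b ⊗ a`. -/
def superSymmetry : A ⊗[k] B ≃ₗ[k] B ⊗[k] A :=
  TensorProduct.congr (DirectSum.decomposeLinearEquiv 𝒜) (DirectSum.decomposeLinearEquiv ℬ)
    ≪≫ₗ TensorProduct.gradedComm k (𝒜 ·) (ℬ ·)
    ≪≫ₗ (TensorProduct.congr (DirectSum.decomposeLinearEquiv ℬ)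
      (DirectSum.decomposeLinearEquiv 𝒜)).symm

theorem superSymmetry_tmul {i j : ZMod 2} {a : A} {b : B} (ha : a ∈ 𝒜 i) (hb : b ∈ ℬ j) :
    superSymmetry 𝒜 ℬ (a ⊗ₜ b) = (-1 : ℤˣ) ^ (j * i) • (b ⊗ₜ[k] a) := by
  rw [superSymmetry, LinearEquiv.trans_apply, LinearEquiv.trans_apply, LinearEquiv.symm_apply_eq,
    TensorProduct.congr_tmul, DirectSum.decomposeLinearEquiv_apply,
    DirectSum.decomposeLinearEquiv_apply, DirectSum.decompose_of_mem _ ha,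
    DirectSum.decompose_of_mem _ hb, ← DirectSum.lof_eq_of k, ← DirectSum.lof_eq_of k,
    TensorProduct.gradedComm_of_tmul_of, Units.smul_def, Units.smul_def, map_zsmul,
    TensorProduct.congr_tmul, DirectSum.decomposeLinearEquiv_apply,
    DirectSum.decomposeLinearEquiv_apply, DirectSum.decompose_of_mem _ ha,
    DirectSum.decompose_of_mem _ hb, ← DirectSum.lof_eq_of k, ← DirectSum.lof_eq_of k]

/-- The middle-four interchange
`(a ⊗ a') ⊗ (b ⊗ b') ↦ (-1)^(|a'||b|) (a ⊗ b) ⊗ (a' ⊗ b')`. -/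
def superInterchange : (A ⊗[k] A) ⊗[k] (B ⊗[k] B) →ₗ[k] (A ⊗[k] B) ⊗[k] (A ⊗[k] B) :=
  (TensorProduct.assoc k A B (A ⊗[k] B)).symm.toLinearMap
    ∘ₗ LinearMap.lTensor A
        ((TensorProduct.assoc k B A B).toLinearMap
          ∘ₗ LinearMap.rTensor B (superSymmetry 𝒜 ℬ).toLinearMap
          ∘ₗ (TensorProduct.assoc k A B B).symm.toLinearMap)
    ∘ₗ (TensorProduct.assoc k A A (B ⊗[k] B)).toLinearMap

/-- The comultiplication of the tensor product of two super-coalgebras. -/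
def tensorComul (ΔA : A →ₗ[k] A ⊗[k] A) (ΔB : B →ₗ[k] B ⊗[k] B) :
    A ⊗[k] B →ₗ[k] (A ⊗[k] B) ⊗[k] (A ⊗[k] B) :=
  superInterchange 𝒜 ℬ ∘ₗ TensorProduct.map ΔA ΔB

/-- The counit of the tensor product of two super-coalgebras. -/
def tensorCounit (εA : A →ₗ[k] k) (εB : B →ₗ[k] k) : A ⊗[k] B →ₗ[k] k :=
  LinearMap.mul' k k ∘ₗ TensorProduct.map εA εB

end SuperTensor

/-- The monomial `a₁^r₁ ⋯ a_m^r_m x₁ ⋯ x_n` in `𝐔(g)`: `r` gives the exponents of the finitely many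
members of the even family that occur, `s` is the set of the members of the odd family that occur,
and the factors are in increasing order. -/
def superMonomial {k g : Type*} [CommRing k] [AddCommGroup g] [Module k g]
    {𝒢 : ZMod 2 → Submodule k g} [DirectSum.Decomposition 𝒢] [LieSuperalgebra 𝒢]
    (q : TwoOperation 𝒢) {X₀ X₁ : Type*} [LinearOrder X₀] [LinearOrder X₁]
    (b₀ : X₀ → 𝒢 0) (b₁ : X₁ → 𝒢 1) (r : X₀ →₀ ℕ) (s : Finset X₁) : SuperEnveloping q :=
  (r.support.sort.map fun a => SuperEnveloping.ι q (b₀ a : g) ^ r a).prod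
    * (s.sort.map fun x => SuperEnveloping.ι q (b₁ x : g)).prod

end

noncomputable section

/-! The relations of 𝐔(g) let every product be put in order, so ordered monomials span. The content
is their independence, and it is obtained by making 𝐔(g) act on the expected answer.

Let M be the free left U(g₀)-module on the finite subsets S of an ordered basis of g₁. Even elements
act by left multiplication. An odd v has to obey v a = a v + [v, a], so its action is determined by
its values on the sets S (`SuperPBW.odd`). For a basis element x and S = {y} ∪ t with y least, these
values are forced: x · S is {x} ∪ S if x < y, it is y^⟨2⟩ · t if x = y, and it is [x, y] · t - y ·
(x · t) if x > y. In the last case x · t has the same degree as S, so the recursion is legitimate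
only after the leading term, the exterior product x ∧ t, has been split off; the remainder has
smaller degree.

The main point is `SuperPBW.sqOn`: v · (v · n) = v^⟨2⟩ · n for all odd v and all n. It is proved by
induction on the degree, using the Jacobi identity, [[v, v], v] = 0 and the axioms of the
2-operation; polarization then gives the bracket relation. Hence 𝐔(g) acts on M, and u ↦ u · ∅ is
inverse to r S ↦ r x₁ ⋯ xₙ (`SuperPBW.orderedEquiv`).

For (1) this is combined with the classical Poincaré–Birkhoff–Witt basis of U(g₀) (`PBW.basis`),
proved in the same way from an action on polynomials (`PBW.action_comm`). For (2), M is U(g₀) ⊗ ⋀ g₁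
and the isomorphism is r ⊗ w ↦ r w, with w written in increasing monomials. The map ⋀ g₁ → 𝐔(g) is
not multiplicative, but it respects comultiplications: expanding Δ(x₁) ⋯ Δ(xₙ) only produces
increasing products, with the same signs on both sides. -/

theorem Module.Basis.induction_on {k M X : Type*} [Semiring k] [AddCommMonoid M] [Module k M]
    (b : Module.Basis X k M) {p : M → Prop} (v : M) (zero : p 0) (basis : ∀ x, p (b x))
    (add : ∀ v w, p v → p w → p (v + w)) (smul : ∀ (c : k) v, p v → p (c • v)) : p v :=
  Submodule.span_induction (p := fun v _ => p v) (by rintro _ ⟨x, rfl⟩; exact basis x) zero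
    (fun v w _ _ => add v w) (fun c v _ => smul c v) (b.mem_span v)

/-- All inductions on the degree of a monomial peel off its least factor, which is the leftmost one
in the ordered product. -/
theorem Multiset.eq_zero_or_exists_cons_min {X : Type*} [LinearOrder X] (S : Multiset X) :
    S = 0 ∨ ∃ (y : X) (t : Multiset X), S = y ::ₘ t ∧ ∀ z ∈ t, y ≤ z := by
  rcases h : S.sort with _ | ⟨y, t⟩
  · left
    rw [← S.sort_eq (· ≤ ·), h]
    rfl
  · right
    have hs := S.pairwise_sort (· ≤ ·)
    rw [h, List.pairwise_cons] at hs
    exact ⟨y, t, by rw [← S.sort_eq (· ≤ ·), h]; rfl, by simpa using hs.1⟩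

/-! ### Classical Poincaré–Birkhoff–Witt: the action of a Lie algebra on polynomials -/

namespace PBW

section Filtration

variable {k X : Type*} [CommRing k]

variable (k) in
/-- The monomial given by a multiset, as a basis element of the space of polynomials. -/
abbrev mono (S : Multiset X) : Multiset X →₀ k := Finsupp.single S 1

variable (k X) in
/-- The polynomials of degree at most `d`. -/
def filt (d : ℕ) : Submodule k (Multiset X →₀ k) :=
  Submodule.span k (mono k '' {S | S.card ≤ d})

theorem mono_mem_filt {S : Multiset X} {d : ℕ} (h : S.card ≤ d) : mono k S ∈ filt k X d :=
  Submodule.subset_span ⟨S, h, rfl⟩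

theorem filt_mono {d e : ℕ} (h : d ≤ e) : filt k X d ≤ filt k X e :=
  Submodule.span_mono (Set.image_mono fun _ hS => le_trans hS h)

theorem mem_of_mem_filt {N : Type*} [AddCommGroup N] [Module k N] {d : ℕ}
    (f : (Multiset X →₀ k) →ₗ[k] N) (M : Submodule k N)
    (h : ∀ S : Multiset X, S.card ≤ d → f (mono k S) ∈ M) {p : Multiset X →₀ k}
    (hp : p ∈ filt k X d) : f p ∈ M := by
  have : filt k X d ≤ M.comap f := by
    rw [filt, Submodule.span_le]
    rintro _ ⟨S, hS, rfl⟩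
    exact h S hS
  exact this hp

theorem eq_of_mem_filt {N : Type*} [AddCommGroup N] [Module k N] {d : ℕ}
    (f f' : (Multiset X →₀ k) →ₗ[k] N)
    (h : ∀ S : Multiset X, S.card ≤ d → f (mono k S) = f' (mono k S)) {p : Multiset X →₀ k}
    (hp : p ∈ filt k X d) : f p = f' p := by
  have := mem_of_mem_filt (f - f') ⊥ (fun S hS => by simp [h S hS]) hp
  simpa [sub_eq_zero] using this

theorem mem_filt_of_forall (p : Multiset X →₀ k) : ∃ d, p ∈ filt k X d := by
  induction p using Finsupp.induction_linear with
  | zero => exact ⟨0, zero_mem _⟩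
  | add p p' h h' =>
    obtain ⟨d, h⟩ := h
    obtain ⟨e, h'⟩ := h'
    exact ⟨max d e, add_mem (filt_mono (le_max_left _ _) h) (filt_mono (le_max_right _ _) h')⟩
  | single S c =>
    refine ⟨S.card, ?_⟩
    rw [← mul_one c, ← smul_eq_mul, ← Finsupp.smul_single]
    exact Submodule.smul_mem _ _ (mono_mem_filt le_rfl)

/-- If basis elements act as multiplication up to terms of no larger degree than the argument, then
every element of `L` raises the degree by at most one. -/
theorem mem_filt_succ_of_sub_mem {L : Type*} [AddCommGroup L] [Module k L]
    (b : Module.Basis X k L) (ρ : L →ₗ[k] Module.End k (Multiset X →₀ k)) {d : ℕ}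
    (h : ∀ x (S : Multiset X), S.card ≤ d →
      ρ (b x) (mono k S) - mono k (x ::ₘ S) ∈ filt k X S.card)
    (v : L) {p : Multiset X →₀ k} (hp : p ∈ filt k X d) : ρ v p ∈ filt k X (d + 1) := by
  induction v using b.induction_on with
  | zero => simp
  | add v w hv hw => rw [map_add]; exact add_mem hv hw
  | smul c v hv => rw [map_smul]; exact Submodule.smul_mem _ _ hv
  | basis x =>
    refine mem_of_mem_filt _ _ (fun S hS => ?_) hp
    rw [← sub_add_cancel (ρ (b x) (mono k S)) (mono k (x ::ₘ S))]
    exact add_mem (filt_mono (by lia) (h x S hS)) (mono_mem_filt (by simpa using hS))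

end Filtration

variable {k L X : Type*} [CommRing k] [LieRing L] [LieAlgebra k L] [LinearOrder X]
  (b : Module.Basis X k L)

/-- The correction to the leading term `x · l` of the action of `b x` on a sorted list `l`, in terms
of an action on monomials of smaller degree. -/
def corr (ρ : L →ₗ[k] Module.End k (Multiset X →₀ k)) (x : X) : List X → (Multiset X →₀ k)
  | [] => 0
  | y :: t => if x ≤ y then 0 else
      ρ (b y) (ρ (b x) (mono k t) - mono k (x ::ₘ t)) + ρ ⁅b x, b y⁆ (mono k t)

/-- One step in the recursive construction of the action of `L` on polynomials. -/
def step (ρ : L →ₗ[k] Module.End k (Multiset X →₀ k)) : L →ₗ[k] Module.End k (Multiset X →₀ k) :=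
  b.constr k fun x => Finsupp.lift _ k _ fun S => mono k (x ::ₘ S) + corr b ρ x S.sort

theorem step_mono (ρ : L →ₗ[k] Module.End k (Multiset X →₀ k)) (x : X) (S : Multiset X) :
    step b ρ (b x) (mono k S) = mono k (x ::ₘ S) + corr b ρ x S.sort := by
  simp [step, Module.Basis.constr_basis]

/-- The action of `L` on polynomials of degree at most `n`. -/
def approx : ℕ → L →ₗ[k] Module.End k (Multiset X →₀ k)
  | 0 => step b 0
  | n + 1 => step b (approx n)

/-- Lets the branch of `corr` that ignores `ρ` be evaluated uniformly in `n`, including `n = 0`. -/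
theorem exists_approx_eq_step (n : ℕ) : ∃ ρ, approx b n = step b ρ := by
  cases n with
  | zero => exact ⟨_, rfl⟩
  | succ n => exact ⟨_, rfl⟩

theorem approx_mono_of_le (n : ℕ) {x : X} {S : Multiset X} (h : ∀ z ∈ S, x ≤ z) :
    approx b n (b x) (mono k S) = mono k (x ::ₘ S) := by
  obtain ⟨ρ, hρ⟩ := exists_approx_eq_step b n
  rw [hρ, step_mono, add_eq_left]
  rcases hS : S.sort with _ | ⟨y, t⟩
  · rw [hS, corr]
  · have : y ∈ S := by rw [← Multiset.mem_sort (r := (· ≤ ·)), hS]; simp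
    rw [hS, corr, if_pos (h y this)]

/-- The value is forced by x (y t) = y (x t) + [x, y] t: the leading part x ∪ t of x · t is sent by
y to the monomial x y t, because y is least, and only the remainder needs the previous
approximation. -/
theorem approx_succ_mono_cons (n : ℕ) {x y : X} {t : Multiset X} (ht : ∀ z ∈ t, y ≤ z)
    (hxy : y < x) :
    approx b (n + 1) (b x) (mono k (y ::ₘ t)) = mono k (x ::ₘ y ::ₘ t)
      + (approx b n (b y) (approx b n (b x) (mono k t) - mono k (x ::ₘ t))
        + approx b n ⁅b x, b y⁆ (mono k t)) := by
  rw [approx, step_mono, Multiset.sort_cons _ _ _ ht, corr, if_neg (not_le.2 hxy),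
    Multiset.sort_eq]

/-- In the correction for S = y t, the remainder of x · t has degree at most |t|, and y, like [x,
y], raises the degree by at most one; so the correction has degree at most |t| + 1 = |S|. -/
theorem approx_sub_mem (n : ℕ) (x : X) (S : Multiset X) (hS : S.card ≤ n) :
    approx b n (b x) (mono k S) - mono k (x ::ₘ S) ∈ filt k X S.card := by
  induction n generalizing x S with
  | zero =>
    have : S = 0 := by simpa using hS
    subst this
    simp [approx_mono_of_le]
  | succ n ih =>
    rcases S.eq_zero_or_exists_cons_min with rfl | ⟨y, t, rfl, ht⟩
    · simp [approx_mono_of_le]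
    · rcases le_or_gt x y with hxy | hxy
      · rw [approx_mono_of_le b _ (by
          intro z hz
          rcases Multiset.mem_cons.1 hz with rfl | hz
          exacts [hxy, hxy.trans (ht z hz)]), sub_self]
        exact zero_mem _
      · have hc : t.card ≤ n := by simpa using hS
        rw [approx_succ_mono_cons b n ht hxy, add_sub_cancel_left, Multiset.card_cons]
        refine add_mem ?_ ?_
        · exact mem_filt_succ_of_sub_mem b _ (fun x S hS => ih x S (hS.trans hc)) _
            (ih x t hc)
        · exact mem_filt_succ_of_sub_mem b _ (fun x S hS => ih x S (hS.trans hc)) _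
            (mono_mem_filt le_rfl)

/-- The recursion for S = y t calls the previous stage only on elements of degree at most |t|, where
it is already stable. This makes `action` well behaved although its stage varies with the monomial.
-/
theorem approx_succ_eq (n : ℕ) (v : L) {p : Multiset X →₀ k} (hp : p ∈ filt k X n) :
    approx b (n + 1) v p = approx b n v p := by
  induction n generalizing v p with
  | zero =>
    induction v using b.induction_on with
    | zero => simp
    | add v w hv hw => simp [hv, hw]
    | smul c v hv => simp [hv]
    | basis x =>
      refine eq_of_mem_filt _ _ (fun S hS => ?_) hp
      have : S = 0 := by simpa using hS
      subst this
      simp [approx_mono_of_le]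
  | succ n ih =>
    induction v using b.induction_on with
    | zero => simp
    | add v w hv hw => simp [hv, hw]
    | smul c v hv => simp [hv]
    | basis x =>
      refine eq_of_mem_filt _ _ (fun S hS => ?_) hp
      rcases S.eq_zero_or_exists_cons_min with rfl | ⟨y, t, rfl, ht⟩
      · simp [approx_mono_of_le]
      · rcases le_or_gt x y with hxy | hxy
        · have h : ∀ z ∈ y ::ₘ t, x ≤ z := by
            intro z hz
            rcases Multiset.mem_cons.1 hz with rfl | hz
            exacts [hxy, hxy.trans (ht z hz)]
          rw [approx_mono_of_le b _ h, approx_mono_of_le b _ h]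
        · have hc : t.card ≤ n := by simpa using hS
          rw [approx_succ_mono_cons b _ ht hxy, approx_succ_mono_cons b _ ht hxy,
            ih _ (mono_mem_filt hc), ih _ (mono_mem_filt hc),
            ih _ (filt_mono hc (approx_sub_mem b n x t hc))]

theorem approx_eq_of_le {m n : ℕ} (h : m ≤ n) (v : L) {p : Multiset X →₀ k}
    (hp : p ∈ filt k X m) : approx b n v p = approx b m v p := by
  induction n, h using Nat.le_induction with
  | base => rfl
  | succ n hmn ih => rw [approx_succ_eq b n v (filt_mono hmn hp), ih]

/-- The action of `L` on polynomials in a basis of `L`. -/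
def action : L →ₗ[k] Module.End k (Multiset X →₀ k) :=
  b.constr k fun x => Finsupp.lift _ k _ fun S => approx b S.card (b x) (mono k S)

theorem action_eq_approx (n : ℕ) (v : L) {p : Multiset X →₀ k} (hp : p ∈ filt k X n) :
    action b v p = approx b n v p := by
  induction v using b.induction_on with
  | zero => simp
  | add v w hv hw => simp [hv, hw]
  | smul c v hv => simp [hv]
  | basis x =>
    refine eq_of_mem_filt _ _ (fun S hS => ?_) hp
    rw [approx_eq_of_le b hS _ (mono_mem_filt le_rfl)]
    simp [action, Module.Basis.constr_basis]

theorem action_mono_of_le {x : X} {S : Multiset X} (h : ∀ z ∈ S, x ≤ z) :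
    action b (b x) (mono k S) = mono k (x ::ₘ S) := by
  rw [action_eq_approx b _ _ (mono_mem_filt le_rfl), approx_mono_of_le b _ h]

theorem action_sub_mem (x : X) (S : Multiset X) :
    action b (b x) (mono k S) - mono k (x ::ₘ S) ∈ filt k X S.card := by
  rw [action_eq_approx b _ _ (mono_mem_filt le_rfl)]
  exact approx_sub_mem b _ x S le_rfl

/-- The commutation relation that the recursion was designed to satisfy. -/
theorem action_action_mono {x y : X} {t : Multiset X} (ht : ∀ z ∈ t, y ≤ z) (hxy : y < x) :
    action b (b x) (action b (b y) (mono k t))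
      = action b (b y) (action b (b x) (mono k t)) + action b ⁅b x, b y⁆ (mono k t) := by
  have hy : ∀ z ∈ x ::ₘ t, y ≤ z := by
    intro z hz
    rcases Multiset.mem_cons.1 hz with rfl | hz
    exacts [hxy.le, ht z hz]
  -- The monomial y t is evaluated one stage later than t, so that the recursive formula can be
  -- unfolded exactly once.
  have h1 := action_eq_approx b (t.card + 1) (b x) (p := mono k (y ::ₘ t))
    (mono_mem_filt (by simp))
  have h2 := action_eq_approx b t.card (b x) (p := mono k t) (mono_mem_filt le_rfl)
  have h3 := action_eq_approx b t.card (b y) (approx_sub_mem b t.card x t le_rfl)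
  have h4 := action_eq_approx b t.card ⁅b x, b y⁆ (p := mono k t) (mono_mem_filt le_rfl)
  rw [action_mono_of_le b ht, h1, approx_succ_mono_cons b _ ht hxy, ← h3, ← h2, ← h4, map_sub,
    action_mono_of_le b hy, Multiset.cons_swap]
  abel

theorem action_comm_mono_of_le {x y : X} {t : Multiset X} (ht : ∀ z ∈ t, y ≤ z) :
    action b (b x) (action b (b y) (mono k t)) - action b (b y) (action b (b x) (mono k t))
      = action b ⁅b x, b y⁆ (mono k t) := by
  rcases lt_trichotomy x y with h | rfl | h
  · rw [action_action_mono b (fun z hz => h.le.trans (ht z hz)) h, ← lie_skew, map_neg]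
    simp
  · simp
  · rw [action_action_mono b ht h, add_sub_cancel_left]

theorem action_comm_of_basis {p : Multiset X →₀ k}
    (h : ∀ x z, action b (b x) (action b (b z) p) - action b (b z) (action b (b x) p)
      = action b ⁅b x, b z⁆ p) (v w : L) :
    action b v (action b w p) - action b w (action b v p) = action b ⁅v, w⁆ p := by
  induction v using b.induction_on with
  | zero => simp
  | add v v' hv hv' =>
    simp only [map_add, LinearMap.add_apply, add_lie, ← hv, ← hv']; abel
  | smul c v hv => simp only [map_smul, LinearMap.smul_apply, smul_lie, ← hv, smul_sub]
  | basis x =>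
    induction w using b.induction_on with
    | zero => simp
    | add v v' hv hv' =>
      simp only [map_add, LinearMap.add_apply, lie_add, ← hv, ← hv']; abel
    | smul c v hv => simp only [map_smul, LinearMap.smul_apply, lie_smul, ← hv, smul_sub]
    | basis z => exact h x z

/-- For basis elements x, z and a monomial y t, the relation holds by construction unless both x and
z exceed the least factor y. In that case y t is written as y · t, both orders are moved past y, and
the Jacobi identity identifies what is left. -/
theorem action_comm_of_mem {d : ℕ} {p : Multiset X →₀ k} (hp : p ∈ filt k X d) (v w : L) :
    action b v (action b w p) - action b w (action b v p) = action b ⁅v, w⁆ p := by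
  induction d generalizing v w p with
  | zero =>
    refine eq_of_mem_filt (action b v ∘ₗ action b w - action b w ∘ₗ action b v) _
      (fun S hS => ?_) hp
    have : S = 0 := by simpa using hS
    subst this
    exact action_comm_of_basis b (fun x z => action_comm_mono_of_le b (by simp)) v w
  | succ d ih =>
    refine eq_of_mem_filt (action b v ∘ₗ action b w - action b w ∘ₗ action b v) _
      (fun S hS => ?_) hp
    refine action_comm_of_basis b (fun x z => ?_) v w
    rcases S.eq_zero_or_exists_cons_min with rfl | ⟨y, t, rfl, ht⟩
    · exact action_comm_mono_of_le b (by simp)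
    by_cases hz : z ≤ y
    · refine action_comm_mono_of_le b fun u hu => ?_
      rcases Multiset.mem_cons.1 hu with rfl | hu
      exacts [hz, hz.trans (ht u hu)]
    by_cases hx : x ≤ y
    · rw [← neg_sub, action_comm_mono_of_le b (x := z), ← lie_skew (b x), map_neg]
      · simp
      intro u hu
      rcases Multiset.mem_cons.1 hu with rfl | hu
      exacts [hx, hx.trans (ht u hu)]
    rw [not_le] at hx hz
    have hc : t.card ≤ d := by simpa using hS
    have ht' : mono k t ∈ filt k X d := mono_mem_filt hc
    -- Here z · t is its leading monomial plus a remainder of degree at most |t|. On the monomial z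
    -- t, y is still least and the relation holds by construction; on the remainder it is the
    -- induction hypothesis.
    have key : ∀ x z, y < x → y < z → action b (b x) (action b (b y) (action b (b z) (mono k t)))
        = action b (b y) (action b (b x) (action b (b z) (mono k t)))
          + action b ⁅b x, b y⁆ (action b (b z) (mono k t)) := by
      intro x z hx hz
      rw [← sub_eq_iff_eq_add']
      have h1 := ih (filt_mono hc (action_sub_mem b z t)) (b x) (b y)
      have h2 := action_comm_mono_of_le b (x := x) (y := y) (t := z ::ₘ t) (by
        intro u hu
        rcases Multiset.mem_cons.1 hu with rfl | hu
        exacts [hz.le, ht u hu])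
      simp only [map_sub] at h1
      rw [← h2] at h1
      linear_combination (norm := module) h1
    have e := action_mono_of_le b ht
    have kx := key x z hx hz
    have kz := key z x hz hx
    have a1 := congrArg (action b (b x)) (action_action_mono b ht hz)
    have a2 := congrArg (action b (b z)) (action_action_mono b ht hx)
    have a3 := ih ht' (b x) ⁅b z, b y⁆
    have a4 := ih ht' (b z) ⁅b x, b y⁆
    have a5 := congrArg (action b (b y)) (ih ht' (b x) (b z))
    have a6 := ih ht' ⁅b x, b z⁆ (b y)
    have j : ⁅⁅b x, b z⁆, b y⁆ = ⁅b x, ⁅b z, b y⁆⁆ - ⁅b z, ⁅b x, b y⁆⁆ := lie_lie _ _ _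
    have j' := congrArg (fun v => action b v (mono k t)) j
    simp only [map_add, map_sub, LinearMap.sub_apply] at a1 a2 a5 j'
    rw [← e]
    -- After both products are moved past y, the difference is y [x, z] t + [x, [z, y]] t - [z, [x,
    -- y]] t; by Jacobi this is [x, z] y t.
    linear_combination (norm := module) a1 - a2 + kx - kz + a3 - a4 + a5 - a6 - j'

theorem action_comm (v w : L) (p : Multiset X →₀ k) :
    action b v (action b w p) - action b w (action b v p) = action b ⁅v, w⁆ p :=
  let ⟨_, hd⟩ := mem_filt_of_forall p
  action_comm_of_mem b hd v w

-- Classical Poincaré–Birkhoff–Witt: comparison of polynomials with U(L)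

attribute [local instance 100] LieRing.ofAssociativeRing

/-- The action of `L` on polynomials as a homomorphism of Lie algebras. -/
def actionHom : L →ₗ⁅k⁆ Module.End k (Multiset X →₀ k) where
  toLinearMap := action b
  map_lie' {v w} := by
    ext1 S
    ext1
    exact (action_comm b v w _).symm

/-- The action of `U(L)` on polynomials. -/
def envelopingAction : UniversalEnvelopingAlgebra k L →ₐ[k] Module.End k (Multiset X →₀ k) :=
  UniversalEnvelopingAlgebra.lift k (actionHom b)

theorem envelopingAction_ι (v : L) :
    envelopingAction b (UniversalEnvelopingAlgebra.ι k v) = action b v :=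
  UniversalEnvelopingAlgebra.lift_ι_apply k _ v

/-- The monomial in `U(L)` given by a multiset, the factors being in increasing order. -/
def monomial (S : Multiset X) : UniversalEnvelopingAlgebra k L :=
  (S.sort.map fun x => UniversalEnvelopingAlgebra.ι k (b x)).prod

theorem monomial_cons {y : X} {t : Multiset X} (ht : ∀ z ∈ t, y ≤ z) :
    monomial b (y ::ₘ t) = UniversalEnvelopingAlgebra.ι k (b y) * monomial b t := by
  simp [monomial, Multiset.sort_cons _ _ _ ht]

/-- The map from polynomials to `U(L)` that sends a monomial to the ordered product. -/
def ordered : (Multiset X →₀ k) →ₗ[k] UniversalEnvelopingAlgebra k L :=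
  Finsupp.lift _ k _ (monomial b)

theorem ordered_mono (S : Multiset X) : ordered b (mono k S) = monomial b S := by
  simp [ordered]

/-- Applied from right to left, each factor of an increasing product is at most all those already
present, so no correction occurs. This gives the independence of the ordered monomials. -/
theorem envelopingAction_monomial (S : Multiset X) :
    envelopingAction b (monomial b S) (mono k 0) = mono k S := by
  induction h : S.card generalizing S with
  | zero =>
    have : S = 0 := by simpa using h
    subst this
    simp [monomial]
  | succ n ih =>
    rcases S.eq_zero_or_exists_cons_min with rfl | ⟨y, t, rfl, ht⟩
    · simp at h
    · rw [monomial_cons b ht, map_mul, Module.End.mul_apply, ih t (by simpa using h),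
        envelopingAction_ι, action_mono_of_le b ht]

/-- The recursion defining the action copies a computation valid in U(L), so `ordered` intertwines
the action with left multiplication. Applied to the monomial 1, this gives that ordered monomials
span. -/
theorem ordered_action_of_mem {d : ℕ} {p : Multiset X →₀ k} (hp : p ∈ filt k X d) (v : L) :
    ordered b (action b v p) = UniversalEnvelopingAlgebra.ι k v * ordered b p := by
  induction d generalizing v p with
  | zero =>
    induction v using b.induction_on with
    | zero => simp
    | add v w hv hw => simp only [map_add, LinearMap.add_apply, hv, hw, add_mul]
    | smul c v hv => simp only [map_smul, LinearMap.smul_apply, hv, smul_mul_assoc]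
    | basis x =>
      refine eq_of_mem_filt (ordered b ∘ₗ action b (b x))
        (LinearMap.mulLeft k (UniversalEnvelopingAlgebra.ι k (b x)) ∘ₗ ordered b)
        (fun S hS => ?_) hp
      have : S = 0 := by simpa using hS
      subst this
      simp only [LinearMap.comp_apply, LinearMap.mulLeft_apply]
      rw [action_mono_of_le b (by simp), ordered_mono, monomial_cons b (by simp), ordered_mono]
  | succ d ih =>
    induction v using b.induction_on with
    | zero => simp
    | add v w hv hw => simp only [map_add, LinearMap.add_apply, hv, hw, add_mul]
    | smul c v hv => simp only [map_smul, LinearMap.smul_apply, hv, smul_mul_assoc]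
    | basis x =>
      refine eq_of_mem_filt (ordered b ∘ₗ action b (b x))
        (LinearMap.mulLeft k (UniversalEnvelopingAlgebra.ι k (b x)) ∘ₗ ordered b)
        (fun S hS => ?_) hp
      simp only [LinearMap.comp_apply, LinearMap.mulLeft_apply]
      have easy : ∀ {x : X} {S : Multiset X}, (∀ z ∈ S, x ≤ z) →
          ordered b (action b (b x) (mono k S))
            = UniversalEnvelopingAlgebra.ι k (b x) * ordered b (mono k S) := by
        intro x S h
        rw [action_mono_of_le b h, ordered_mono, monomial_cons b h, ordered_mono]
      rcases S.eq_zero_or_exists_cons_min with rfl | ⟨y, t, rfl, ht⟩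
      · exact easy (by simp)
      by_cases hx : x ≤ y
      · refine easy fun u hu => ?_
        rcases Multiset.mem_cons.1 hu with rfl | hu
        exacts [hx, hx.trans (ht u hu)]
      rw [not_le] at hx
      have hc : t.card ≤ d := by simpa using hS
      have ht' : mono k t ∈ filt k X d := mono_mem_filt hc
      -- The element x · t may have degree |t| + 1, out of reach of the induction hypothesis; its
      -- leading monomial is treated by `easy` and only the remainder by `ih`.
      have h1 : ordered b (action b (b y) (action b (b x) (mono k t)))
          = UniversalEnvelopingAlgebra.ι k (b y) * ordered b (action b (b x) (mono k t)) := by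
        have h2 := ih (filt_mono hc (action_sub_mem b x t)) (b y)
        have h3 := easy (x := y) (S := x ::ₘ t) (by
          intro z hz
          rcases Multiset.mem_cons.1 hz with rfl | hz
          exacts [hx.le, ht z hz])
        simp only [map_sub, mul_sub] at h2
        linear_combination (norm := noncomm_ring) h2 + h3
      have h4 := (UniversalEnvelopingAlgebra.ι k).map_lie (b x) (b y)
      rw [LieRing.of_associative_ring_bracket] at h4
      rw [← action_mono_of_le b ht, action_action_mono b ht hx, map_add, h1, ih ht', ih ht', easy ht,
        h4]
      noncomm_ring

theorem ordered_action (v : L) (p : Multiset X →₀ k) :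
    ordered b (action b v p) = UniversalEnvelopingAlgebra.ι k v * ordered b p :=
  let ⟨_, hd⟩ := mem_filt_of_forall p
  ordered_action_of_mem b hd v

end PBW

/-- An induction principle for the universal enveloping algebra, by left multiplication with
elements of the Lie algebra. -/
theorem UniversalEnvelopingAlgebra.induction_mul {k L : Type*} [CommRing k] [LieRing L]
    [LieAlgebra k L] {p : UniversalEnvelopingAlgebra k L → Prop}
    (u : UniversalEnvelopingAlgebra k L) (one : p 1)
    (add : ∀ u v, p u → p v → p (u + v)) (smul : ∀ (c : k) u, p u → p (c • u))
    (mul : ∀ (x : L) u, p u → p (UniversalEnvelopingAlgebra.ι k x * u)) : p u := by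
  obtain ⟨t, rfl⟩ : ∃ t, mkAlgHom k L t = u := RingCon.mkₐ_surjective _ u
  suffices h : ∀ u, p u → p (mkAlgHom k L t * u) by simpa using h 1 one
  induction t using TensorAlgebra.induction with
  | algebraMap r =>
    intro u hu
    rw [AlgHom.commutes, ← Algebra.smul_def]
    exact smul r u hu
  | ι x => exact mul x
  | mul a c ha hc =>
    intro u hu
    rw [map_mul, mul_assoc]
    exact ha _ (hc _ hu)
  | add a c ha hc =>
    intro u hu
    rw [map_add, add_mul]
    exact add _ _ (ha _ hu) (hc _ hu)

namespace PBW

variable {k L X : Type*} [CommRing k] [LieRing L] [LieAlgebra k L] [LinearOrder X]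
  (b : Module.Basis X k L)

theorem ordered_envelopingAction (u : UniversalEnvelopingAlgebra k L) (p : Multiset X →₀ k) :
    ordered b (envelopingAction b u p) = u * ordered b p := by
  induction u using UniversalEnvelopingAlgebra.induction_mul with
  | one => simp
  | add u v hu hv => simp [hu, hv, add_mul]
  | smul c u hu => simp [hu]
  | mul x u hu =>
    rw [map_mul, Module.End.mul_apply, envelopingAction_ι, ordered_action, hu, mul_assoc]

/-- The **Poincaré–Birkhoff–Witt theorem**: the ordered monomials in a basis of a Lie algebra form
a basis of its universal enveloping algebra. -/
def basis : Module.Basis (Multiset X) k (UniversalEnvelopingAlgebra k L) where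
  repr := LinearEquiv.symm
    { ordered b with
      invFun := fun u => envelopingAction b u (mono k 0)
      left_inv := by
        intro p
        induction p using Finsupp.induction_linear with
        | zero => simp
        | add p p' h h' =>
          simp only [AddHom.toFun_eq_coe, LinearMap.coe_toAddHom, map_add,
            LinearMap.add_apply] at h h' ⊢
          rw [h, h']
        | single S c =>
          rw [← mul_one c, ← smul_eq_mul, ← Finsupp.smul_single]
          simp only [AddHom.toFun_eq_coe, LinearMap.coe_toAddHom, map_smul, LinearMap.smul_apply,
            ordered_mono, envelopingAction_monomial]
      right_inv := fun u => by
        change ordered b (envelopingAction b u (mono k 0)) = u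
        rw [ordered_envelopingAction, ordered_mono]
        simp [monomial] }

theorem basis_apply (S : Multiset X) : basis b S = monomial b S :=
  ordered_mono b S

end PBW
end

/-! ### Identities for the even and odd parts of a Lie superalgebra -/

noncomputable section

theorem Finset.eq_empty_or_exists_insert_min {X : Type*} [LinearOrder X] (S : Finset X) :
    S = ∅ ∨ ∃ (y : X) (t : Finset X), S = insert y t ∧ ∀ z ∈ t, y < z := by
  rcases S.eq_empty_or_nonempty with h | h
  · exact Or.inl h
  · exact Or.inr ⟨S.min' h, S.erase (S.min' h), (Finset.insert_erase (S.min'_mem h)).symm,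
      fun z hz => S.min'_lt_of_mem_erase_min' h hz⟩

namespace LieSuperalgebra

variable {k g : Type*} [CommRing k] [AddCommGroup g] [Module k g]
  (𝒢 : ZMod 2 → Submodule k g) [DirectSum.Decomposition 𝒢] [LieSuperalgebra 𝒢]

/-- The bracket of an odd and an even element. -/
def oddEven : 𝒢 1 →ₗ[k] 𝒢 0 →ₗ[k] 𝒢 1 :=
  LinearMap.mk₂ k (fun v a => ⟨bracket 𝒢 (v : g) (a : g), by
      simpa using bracket_mem (𝒢 := 𝒢) v.2 a.2⟩)
    (fun _ _ _ => Subtype.ext (by simp)) (fun _ _ _ => Subtype.ext (by simp))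
    (fun _ _ _ => Subtype.ext (by simp)) (fun _ _ _ => Subtype.ext (by simp))

/-- The bracket of two odd elements. -/
def oddOdd : 𝒢 1 →ₗ[k] 𝒢 1 →ₗ[k] 𝒢 0 :=
  LinearMap.mk₂ k (fun v w => ⟨bracket 𝒢 (v : g) (w : g), bracket_mem (𝒢 := 𝒢) v.2 w.2⟩)
    (fun _ _ _ => Subtype.ext (by simp)) (fun _ _ _ => Subtype.ext (by simp))
    (fun _ _ _ => Subtype.ext (by simp)) (fun _ _ _ => Subtype.ext (by simp))

theorem coe_oddEven (v : 𝒢 1) (a : 𝒢 0) :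
    (oddEven 𝒢 v a : g) = bracket 𝒢 (v : g) (a : g) := rfl

theorem coe_oddOdd (v w : 𝒢 1) : (oddOdd 𝒢 v w : g) = bracket 𝒢 (v : g) (w : g) := rfl

variable {𝒢}

theorem bracket_odd_even (v : 𝒢 1) (a : 𝒢 0) :
    bracket 𝒢 (a : g) (v : g) = -bracket 𝒢 (v : g) (a : g) := by
  have h := skew (𝒢 := 𝒢) a.2 v.2
  simp only [zero_mul, uzpow_zero, one_smul] at h
  exact eq_neg_of_add_eq_zero_left h

theorem bracket_odd_odd (v w : 𝒢 1) :
    bracket 𝒢 (v : g) (w : g) = bracket 𝒢 (w : g) (v : g) := by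
  have h := skew (𝒢 := 𝒢) v.2 w.2
  simp only [mul_one, uzpow_one, Units.neg_smul, one_smul] at h
  exact add_neg_eq_zero.1 h

theorem oddOdd_comm (v w : 𝒢 1) : oddOdd 𝒢 v w = oddOdd 𝒢 w v :=
  Subtype.ext (bracket_odd_odd v w)

/-- The Jacobi identity as the statement that g₁ is a right g₀-module; it is what makes
`SuperPBW.twist` a Lie algebra map. -/
theorem oddEven_lie (v : 𝒢 1) (a c : 𝒢 0) :
    oddEven 𝒢 v ⁅a, c⁆ = oddEven 𝒢 (oddEven 𝒢 v a) c - oddEven 𝒢 (oddEven 𝒢 v c) a := by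
  refine Subtype.ext ?_
  have h := jacobi (𝒢 := 𝒢) v.2 a.2 c.2
  have h1 := bracket_odd_even v ⁅a, c⁆
  have h2 := bracket_odd_even v c
  simp only [add_zero, mul_zero, uzpow_zero, one_smul, h2] at h
  simp only [coe_oddEven, coe_lie_even, Submodule.coe_sub] at h1 ⊢
  rw [h1, map_neg, LinearMap.neg_apply] at h
  linear_combination (norm := module) -h

theorem oddEven_oddOdd (x y z : 𝒢 1) :
    oddEven 𝒢 x (oddOdd 𝒢 z y) + oddEven 𝒢 z (oddOdd 𝒢 x y) + oddEven 𝒢 y (oddOdd 𝒢 x z) = 0 := by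
  refine Subtype.ext ?_
  have h := jacobi (𝒢 := 𝒢) x.2 y.2 z.2
  have e : (1 : ZMod 2) + 1 = 0 := by decide
  have h1 := bracket_odd_even z (oddOdd 𝒢 x y)
  have h2 := bracket_odd_even x (oddOdd 𝒢 y z)
  have h3 := bracket_odd_even y (oddOdd 𝒢 z x)
  simp only [e, mul_zero, zero_mul, uzpow_zero, one_smul] at h
  simp only [Submodule.coe_add, coe_oddEven, coe_oddOdd, Submodule.coe_zero] at h1 h2 h3 ⊢
  rw [h1, h2, h3] at h
  rw [bracket_odd_odd z y, bracket_odd_odd x z]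
  linear_combination (norm := module) -h

variable (q : TwoOperation 𝒢)

theorem TwoOperation.map_add' (v w : 𝒢 1) :
    q.toFun (v + w) = q.toFun v + oddOdd 𝒢 v w + q.toFun w :=
  Subtype.ext (q.map_add v w)

/-- Compute (v + v)^⟨2⟩ = (2v)^⟨2⟩ in two ways. -/
theorem TwoOperation.oddOdd_self (v : 𝒢 1) : oddOdd 𝒢 v v = (2 : k) • q.toFun v := by
  have h := q.map_add' v v
  rw [← two_smul k v, q.map_smul] at h
  linear_combination (norm := module) -h

/-- Since [v^⟨2⟩, v] = [v, [v, v]], this is the axiom [[v, v], v] = 0. -/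
theorem TwoOperation.oddEven_self (v : 𝒢 1) : oddEven 𝒢 v (q.toFun v) = 0 := by
  refine Subtype.ext ?_
  have h1 := bracket_odd_even v (q.toFun v)
  have h2 := q.bracket_eq v v
  have h3 := bracket_odd_even v (oddOdd 𝒢 v v)
  rw [coe_oddOdd, bracket_bracket_self v.2] at h3
  rw [h1, neg_eq_zero.1 h3.symm, neg_eq_zero] at h2
  exact h2

theorem TwoOperation.oddEven_eq (v w : 𝒢 1) :
    oddEven 𝒢 w (q.toFun v) = -oddEven 𝒢 v (oddOdd 𝒢 v w) := by
  refine Subtype.ext ?_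
  have h1 := bracket_odd_even w (q.toFun v)
  rw [q.bracket_eq] at h1
  simp only [Submodule.coe_neg, coe_oddEven, coe_oddOdd, h1, neg_neg]

theorem TwoOperation.lie_eq (v : 𝒢 1) (a : 𝒢 0) :
    ⁅q.toFun v, a⁆ = oddOdd 𝒢 v (oddEven 𝒢 v a) :=
  Subtype.ext (q.bracket_eq v a)

end LieSuperalgebra

open LieSuperalgebra

/-! ### The free U(g₀)-module on finite sets of odd basis elements -/

namespace SuperPBW

variable {k g : Type*} [CommRing k] [AddCommGroup g] [Module k g]
  (𝒢 : ZMod 2 → Submodule k g) [DirectSum.Decomposition 𝒢] [LieSuperalgebra 𝒢]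

section Module

attribute [local instance 100] LieRing.ofAssociativeRing

variable (X : Type*)

/-- The free left `U(g₀)`-module on the finite subsets of `X`. -/
def FreeMod : Type _ := Finset X →₀ UniversalEnvelopingAlgebra k (𝒢 0)

namespace FreeMod

instance : AddCommGroup (FreeMod 𝒢 X) :=
  inferInstanceAs (AddCommGroup (Finset X →₀ UniversalEnvelopingAlgebra k (𝒢 0)))

instance : Module (UniversalEnvelopingAlgebra k (𝒢 0)) (FreeMod 𝒢 X) :=
  inferInstanceAs (Module _ (Finset X →₀ UniversalEnvelopingAlgebra k (𝒢 0)))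

instance : Module k (FreeMod 𝒢 X) :=
  inferInstanceAs (Module k (Finset X →₀ UniversalEnvelopingAlgebra k (𝒢 0)))

instance : IsScalarTower k (UniversalEnvelopingAlgebra k (𝒢 0)) (FreeMod 𝒢 X) :=
  inferInstanceAs (IsScalarTower k _ (Finset X →₀ UniversalEnvelopingAlgebra k (𝒢 0)))

/-- The basis of the free module. -/
def basis : Module.Basis (Finset X) (UniversalEnvelopingAlgebra k (𝒢 0)) (FreeMod 𝒢 X) :=
  .ofRepr (LinearEquiv.refl _ _)

variable {X}

/-- The basis element given by a finite subset of `X`. -/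
def mono (S : Finset X) : FreeMod 𝒢 X := basis 𝒢 X S

variable {𝒢} in
/-- A linear map out of the free module, given by its components. -/
def lsum {M : Type*} [AddCommGroup M] [Module k M]
    (F : Finset X → UniversalEnvelopingAlgebra k (𝒢 0) →ₗ[k] M) : FreeMod 𝒢 X →ₗ[k] M :=
  Finsupp.lsum (M := UniversalEnvelopingAlgebra k (𝒢 0)) k F

variable {𝒢}

theorem smul_mono_eq_single (r : UniversalEnvelopingAlgebra k (𝒢 0)) (S : Finset X) :
    r • mono 𝒢 S = (Finsupp.single S r : Finset X →₀ UniversalEnvelopingAlgebra k (𝒢 0)) :=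
  (Finsupp.smul_single _ _ _).trans (by rw [smul_eq_mul, mul_one])

theorem lsum_smul_mono {M : Type*} [AddCommGroup M] [Module k M]
    (F : Finset X → UniversalEnvelopingAlgebra k (𝒢 0) →ₗ[k] M)
    (r : UniversalEnvelopingAlgebra k (𝒢 0)) (S : Finset X) :
    lsum F (r • mono 𝒢 S) = F S r := by
  rw [smul_mono_eq_single]
  exact Finsupp.lsum_single _ _ _ _

theorem lsum_mono {M : Type*} [AddCommGroup M] [Module k M]
    (F : Finset X → UniversalEnvelopingAlgebra k (𝒢 0) →ₗ[k] M) (S : Finset X) :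
    lsum F (mono 𝒢 S) = F S 1 := by
  rw [← one_smul (UniversalEnvelopingAlgebra k (𝒢 0)) (mono 𝒢 S), lsum_smul_mono]

/-- `P` is not assumed stable under scalars from U(g₀), since odd elements do not act
U(g₀)-linearly. -/
theorem induction_on {P : FreeMod 𝒢 X → Prop} (n : FreeMod 𝒢 X) (zero : P 0)
    (add : ∀ n n', P n → P n' → P (n + n')) 
    (smul_mono : ∀ (r : UniversalEnvelopingAlgebra k (𝒢 0)) (S : Finset X), P (r • mono 𝒢 S)) : P n := by
  have h : n ∈ Submodule.span _ (Set.range (basis 𝒢 X)) := (basis 𝒢 X).mem_span n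
  induction h using Submodule.span_induction with
  | mem n hn =>
    obtain ⟨S, rfl⟩ := hn
    rw [← one_smul (UniversalEnvelopingAlgebra k (𝒢 0)) (basis 𝒢 X S)]
    exact smul_mono 1 S
  | zero => exact zero
  | add n n' _ _ h h' => exact add n n' h h'
  | smul r n hn h =>
    -- That `P` holds for `n` says nothing about `r • n`, so the span is traversed a second time
    -- with the scalar left free.
    clear h
    induction hn using Submodule.span_induction generalizing r with
    | mem n hn =>
      obtain ⟨S, rfl⟩ := hn
      exact smul_mono r S
    | zero => rwa [smul_zero]
    | add n n' _ _ h h' => rw [smul_add]; exact add _ _ (h r) (h' r)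
    | smul r' n _ h => rw [smul_smul]; exact h _

end FreeMod

open FreeMod

/-- The action of `g₀` on the free left `U(g₀)`-module. -/
def even : 𝒢 0 →ₗ[k] Module.End k (FreeMod 𝒢 X) :=
  (Algebra.lsmul k k (FreeMod 𝒢 X)).toLinearMap ∘ₗ
    (UniversalEnvelopingAlgebra.ι k (L := 𝒢 0)).toLinearMap

theorem even_apply (a : 𝒢 0) (n : FreeMod 𝒢 X) :
    even 𝒢 X a n = UniversalEnvelopingAlgebra.ι k a • n := rfl

theorem even_lie (a c : 𝒢 0) (n : FreeMod 𝒢 X) :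
    even 𝒢 X ⁅a, c⁆ n = even 𝒢 X a (even 𝒢 X c n) - even 𝒢 X c (even 𝒢 X a n) := by
  simp only [even_apply, LieHom.map_lie, LieRing.of_associative_ring_bracket, sub_smul, mul_smul]

/-- The action of `g₀` on the linear maps from `g₁` to the free module for which evaluation at odd
elements follows the rule `v a = a v + [v, a]`. -/
def twist : 𝒢 0 →ₗ⁅k⁆ Module.End k (𝒢 1 →ₗ[k] FreeMod 𝒢 X) where
  toFun a := LinearMap.compRight k (even 𝒢 X a) + LinearMap.lcomp k _ ((oddEven 𝒢).flip a)
  map_add' a c := by ext F v : 2; simp; abel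
  map_smul' r a := by ext F v : 2; simp
  map_lie' {a c} := by
    ext F v : 2
    simp only [LieRing.of_associative_ring_bracket, LinearMap.add_apply, LinearMap.sub_apply,
      Module.End.mul_apply, LinearMap.compRight_apply, LinearMap.comp_apply, LinearMap.lcomp_apply,
      LinearMap.flip_apply, map_add, even_lie, oddEven_lie, map_sub]
    abel

theorem twist_apply (a : 𝒢 0) (F : 𝒢 1 →ₗ[k] FreeMod 𝒢 X) (v : 𝒢 1) :
    twist 𝒢 X a F v = even 𝒢 X a (F v) + F (oddEven 𝒢 v a) := rfl

/-- The extension of `twist` to `U(g₀)`. -/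
def twistHom : UniversalEnvelopingAlgebra k (𝒢 0) →ₐ[k]
    Module.End k (𝒢 1 →ₗ[k] FreeMod 𝒢 X) :=
  UniversalEnvelopingAlgebra.lift k (twist 𝒢 X)

variable {X}

/-- The action of `g₁` on the free module with prescribed values on the basis elements that follows
the rule `v a = a v + [v, a]`. -/
def odd (f : Finset X → 𝒢 1 →ₗ[k] FreeMod 𝒢 X) : 𝒢 1 →ₗ[k] Module.End k (FreeMod 𝒢 X) :=
  (lsum fun S => (twistHom 𝒢 X).toLinearMap.flip (f S)).flip

theorem odd_mono (f : Finset X → 𝒢 1 →ₗ[k] FreeMod 𝒢 X) (v : 𝒢 1) (S : Finset X) :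
    odd 𝒢 f v (mono 𝒢 S) = f S v := by
  simp [odd, lsum_mono]

/-- Moving v past a changes v into [v, a], so no single v can be extended alone. All of them are
extended together: `odd` lets r ∈ U(g₀) act on the whole map v ↦ f S v through `twistHom`, and the
rule is multiplicativity of that action. -/
theorem odd_even (f : Finset X → 𝒢 1 →ₗ[k] FreeMod 𝒢 X) (v : 𝒢 1) (a : 𝒢 0) (n : FreeMod 𝒢 X) :
    odd 𝒢 f v (even 𝒢 X a n) = even 𝒢 X a (odd 𝒢 f v n) + odd 𝒢 f (oddEven 𝒢 v a) n := by
  induction n using FreeMod.induction_on with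
  | zero => simp
  | add n n' h h' => simp only [map_add, h, h']; abel
  | smul_mono r S =>
    have e : twistHom 𝒢 X (UniversalEnvelopingAlgebra.ι k a) = twist 𝒢 X a :=
      UniversalEnvelopingAlgebra.lift_ι_apply k _ a
    rw [even_apply, smul_smul]
    simp only [odd, LinearMap.flip_apply, lsum_smul_mono, AlgHom.toLinearMap_apply,
      map_mul, Module.End.mul_apply, e, twist_apply]

/-- The submodule spanned by the subsets of cardinality at most `d`. -/
def filt (X : Type*) (d : ℕ) : Submodule (UniversalEnvelopingAlgebra k (𝒢 0)) (FreeMod 𝒢 X) :=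
  Submodule.span _ (mono 𝒢 '' {S | S.card ≤ d})

variable {𝒢}

theorem mono_mem_filt {S : Finset X} {d : ℕ} (h : S.card ≤ d) : mono 𝒢 S ∈ filt 𝒢 X d :=
  Submodule.subset_span ⟨S, h, rfl⟩

theorem filt_mono {d e : ℕ} (h : d ≤ e) : filt 𝒢 X d ≤ filt 𝒢 X e :=
  Submodule.span_mono (Set.image_mono fun _ hS => le_trans hS h)

theorem mem_filt_of_forall (n : FreeMod 𝒢 X) : ∃ d, n ∈ filt 𝒢 X d := by
  induction n using FreeMod.induction_on with
  | zero => exact ⟨0, zero_mem _⟩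
  | add p p' h h' =>
    obtain ⟨d, h⟩ := h
    obtain ⟨e, h'⟩ := h'
    exact ⟨max d e, add_mem (filt_mono (le_max_left _ _) h) (filt_mono (le_max_right _ _) h')⟩
  | smul_mono r S => exact ⟨S.card, Submodule.smul_mem _ _ (mono_mem_filt le_rfl)⟩

theorem even_mem_filt {d : ℕ} (a : 𝒢 0) {n : FreeMod 𝒢 X} (hn : n ∈ filt 𝒢 X d) :
    even 𝒢 X a n ∈ filt 𝒢 X d :=
  Submodule.smul_mem _ _ hn

/-- Scalars in U(g₀) are reduced to successive multiplications by elements of g₀, for which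
`odd_even` is available. -/
theorem filt_induction {P : FreeMod 𝒢 X → Prop} {d : ℕ} {n : FreeMod 𝒢 X} (hn : n ∈ filt 𝒢 X d)
    (zero : P 0) (add : ∀ n n', P n → P n' → P (n + n')) (smul : ∀ (c : k) n, P n → P (c • n))
    (even : ∀ a n, P n → P (even 𝒢 X a n)) (mono : ∀ S : Finset X, S.card ≤ d → P (mono 𝒢 S)) :
    P n := by
  induction hn using Submodule.span_induction with
  | mem n hn =>
    obtain ⟨S, hS, rfl⟩ := hn
    exact mono S hS
  | zero => exact zero
  | add n n' _ _ h h' => exact add n n' h h'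
  | smul r n _ h =>
    induction r using UniversalEnvelopingAlgebra.induction_mul with
    | one => rwa [one_smul]
    | add u v hu hv => rw [add_smul]; exact add _ _ hu hv
    | smul c u hu => rw [smul_assoc]; exact smul _ _ hu
    | mul x u hu => rw [mul_smul]; exact even _ _ hu

theorem odd_mem {f : Finset X → 𝒢 1 →ₗ[k] FreeMod 𝒢 X} {d e : ℕ}
    (h : ∀ S : Finset X, S.card ≤ d → ∀ v, f S v ∈ filt 𝒢 X e) (v : 𝒢 1)
    {n : FreeMod 𝒢 X} (hn : n ∈ filt 𝒢 X d) : odd 𝒢 f v n ∈ filt 𝒢 X e := by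
  -- The quantifier over `v` belongs to the induction predicate because `odd_even` replaces v by [v,
  -- a].
  refine filt_induction (P := fun n => ∀ v, odd 𝒢 f v n ∈ filt 𝒢 X e) hn (fun v => by simp)
    (fun n n' hn hn' v => ?_) (fun c n hn v => ?_) (fun a n hn v => ?_) (fun S hS v => ?_) v
  · rw [map_add]; exact add_mem (hn v) (hn' v)
  · rw [map_smul]; exact Submodule.smul_of_tower_mem _ _ (hn v)
  · rw [odd_even]; exact add_mem (even_mem_filt _ (hn _)) (hn _)
  · rw [odd_mono]; exact h S hS v

theorem odd_congr {f f' : Finset X → 𝒢 1 →ₗ[k] FreeMod 𝒢 X} {d : ℕ}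
    (h : ∀ S : Finset X, S.card ≤ d → f S = f' S) (v : 𝒢 1)
    {n : FreeMod 𝒢 X} (hn : n ∈ filt 𝒢 X d) : odd 𝒢 f v n = odd 𝒢 f' v n := by
  refine filt_induction (P := fun n => ∀ v, odd 𝒢 f v n = odd 𝒢 f' v n) hn (fun v => by simp)
    (fun n n' hn hn' v => ?_) (fun c n hn v => ?_) (fun a n hn v => ?_) (fun S hS v => ?_) v
  · rw [map_add, map_add, hn, hn']
  · rw [map_smul, map_smul, hn]
  · rw [odd_even, odd_even, hn, hn]
  · rw [odd_mono, odd_mono, h S hS]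

end Module

end SuperPBW
end

/-! ### Recursive construction of the action of the odd part -/

noncomputable section
open LieSuperalgebra

namespace SuperPBW
open FreeMod

variable {k g : Type*} [CommRing k] [AddCommGroup g] [Module k g]
  {𝒢 : ZMod 2 → Submodule k g} [DirectSum.Decomposition 𝒢] [LieSuperalgebra 𝒢]
  {X : Type*} [LinearOrder X]

variable (𝒢) in
/-- The leading term of the action of the basis element `x` on `S`, the exterior product. -/
def lead (x : X) (S : Finset X) : FreeMod 𝒢 X :=
  if x ∈ S then 0 else (-1 : k) ^ (S.filter (· < x)).card • mono 𝒢 (insert x S)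

theorem lead_of_lt {x : X} {S : Finset X} (h : ∀ z ∈ S, x < z) :
    lead 𝒢 x S = mono 𝒢 (insert x S) := by
  rw [lead, if_neg fun hx => lt_irrefl x (h x hx), Finset.filter_false_of_mem, Finset.card_empty,
    pow_zero, one_smul]
  exact fun z hz => not_lt.2 (h z hz).le

theorem lead_insert {x y : X} {t : Finset X} (ht : ∀ z ∈ t, y < z) (hxy : y < x)
    (hx : x ∉ t) : lead 𝒢 x (insert y t)
      = -((-1 : k) ^ (t.filter (· < x)).card • mono 𝒢 (insert y (insert x t))) := by
  have hy : y ∉ t := fun h => lt_irrefl y (ht y h)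
  rw [lead, if_neg (by simp [hxy.ne', hx]), Finset.filter_insert, if_pos hxy,
    Finset.card_insert_of_notMem (by simp [hy]), pow_succ, mul_neg_one, neg_smul, Finset.insert_comm]

theorem lead_mem_filt (x : X) (S : Finset X) : lead 𝒢 x S ∈ filt 𝒢 X (S.card + 1) := by
  rw [lead]
  split_ifs with h
  · exact zero_mem _
  · exact Submodule.smul_of_tower_mem _ _ (mono_mem_filt (Finset.card_insert_le _ _))

/-- A property of the elements `y` less than everything in `t` passes to the leading term. -/
theorem lead_induction {P : FreeMod 𝒢 X → Prop} {x y : X} {t : Finset X} (ht : ∀ z ∈ t, y < z)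
    (hxy : y < x) (zero : P 0) (smul : ∀ (c : k) n, P n → P (c • n))
    (mono : ∀ S : Finset X, (∀ z ∈ S, y < z) → P (mono 𝒢 S)) : P (lead 𝒢 x t) := by
  rw [lead]
  split_ifs with h
  · exact zero
  · refine smul _ _ (mono _ fun z hz => ?_)
    rcases Finset.mem_insert.1 hz with rfl | hz
    exacts [hxy, ht z hz]

variable (q : TwoOperation 𝒢) (b : Module.Basis X k (𝒢 1))

/-- The correction to the leading term of the action of `b x` on a sorted list, in terms of an
action on basis elements of smaller degree. -/
def corr (f : Finset X → 𝒢 1 →ₗ[k] FreeMod 𝒢 X) (x : X) : List X → FreeMod 𝒢 X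
  | [] => 0
  | y :: t => if x < y then 0 else if x = y then even 𝒢 X (q.toFun (b y)) (mono 𝒢 t.toFinset) else
      even 𝒢 X (oddOdd 𝒢 (b x) (b y)) (mono 𝒢 t.toFinset)
        - odd 𝒢 f (b y) (f t.toFinset (b x) - lead 𝒢 x t.toFinset)

/-- One step in the recursive construction of the action of `g₁` on the free module. -/
def step (f : Finset X → 𝒢 1 →ₗ[k] FreeMod 𝒢 X) (S : Finset X) : 𝒢 1 →ₗ[k] FreeMod 𝒢 X :=
  b.constr k fun x => lead 𝒢 x S + corr q b f x S.sort

theorem step_basis (f : Finset X → 𝒢 1 →ₗ[k] FreeMod 𝒢 X) (S : Finset X) (x : X) :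
    step q b f S (b x) = lead 𝒢 x S + corr q b f x S.sort := by
  simp [step, Module.Basis.constr_basis]

/-- The action of `g₁` on the basis elements of degree at most `n`. -/
def approx : ℕ → Finset X → 𝒢 1 →ₗ[k] FreeMod 𝒢 X
  | 0 => step q b 0
  | n + 1 => step q b (approx n)

theorem exists_approx_eq_step (n : ℕ) : ∃ f, approx q b n = step q b f := by
  cases n with
  | zero => exact ⟨_, rfl⟩
  | succ n => exact ⟨_, rfl⟩

theorem approx_of_lt (n : ℕ) {x : X} {S : Finset X} (h : ∀ z ∈ S, x < z) :
    approx q b n S (b x) = mono 𝒢 (insert x S) := by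
  obtain ⟨f, hf⟩ := exists_approx_eq_step q b n
  rw [hf, step_basis, lead_of_lt h, add_eq_left]
  rcases hS : S.sort with _ | ⟨y, t⟩
  · rw [hS, corr]
  · have : y ∈ S := by rw [← Finset.mem_sort (r := (· ≤ ·)), hS]; simp
    rw [hS, corr, if_pos (h y this)]

theorem sort_insert_min {y : X} {t : Finset X} (ht : ∀ z ∈ t, y < z) :
    (insert y t).sort = y :: t.sort :=
  Finset.sort_insert _ (fun z hz => (ht z hz).le) fun h => lt_irrefl y (ht y h)

theorem approx_insert_self (n : ℕ) {y : X} {t : Finset X} (ht : ∀ z ∈ t, y < z) :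
    approx q b n (insert y t) (b y) = even 𝒢 X (q.toFun (b y)) (mono 𝒢 t) := by
  obtain ⟨f, hf⟩ := exists_approx_eq_step q b n
  rw [hf, step_basis, sort_insert_min ht, corr, if_neg (lt_irrefl y), if_pos rfl,
    Finset.sort_toFinset, lead, if_pos (Finset.mem_insert_self _ _), zero_add]

/-- Forced by x (y t) = [x, y] t - y (x t): y sends the leading part x ∧ t of x · t to y ∧ x ∧ t,
which with the minus sign is the leading term x ∧ y ∧ t, and the remainder has degree at most |t|.
-/
theorem approx_succ_insert (n : ℕ) {x y : X} {t : Finset X} (ht : ∀ z ∈ t, y < z) (hxy : y < x) :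
    approx q b (n + 1) (insert y t) (b x) = lead 𝒢 x (insert y t)
      + (even 𝒢 X (oddOdd 𝒢 (b x) (b y)) (mono 𝒢 t)
        - odd 𝒢 (approx q b n) (b y) (approx q b n t (b x) - lead 𝒢 x t)) := by
  rw [approx, step_basis, sort_insert_min ht, corr, if_neg hxy.not_gt, if_neg hxy.ne',
    Finset.sort_toFinset]

theorem card_insert_min {y : X} {t : Finset X} (ht : ∀ z ∈ t, y < z) :
    (insert y t).card = t.card + 1 :=
  Finset.card_insert_of_notMem fun h => lt_irrefl y (ht y h)

theorem mem_filt_of_sub_lead_mem {f : 𝒢 1 →ₗ[k] FreeMod 𝒢 X} {S : Finset X}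
    (h : ∀ x, f (b x) - lead 𝒢 x S ∈ filt 𝒢 X S.card) (v : 𝒢 1) : f v ∈ filt 𝒢 X (S.card + 1) := by
  induction v using b.induction_on with
  | zero => simp
  | add v w hv hw => rw [map_add]; exact add_mem hv hw
  | smul c v hv => rw [map_smul]; exact Submodule.smul_of_tower_mem _ _ hv
  | basis x =>
    rw [← sub_add_cancel (f (b x)) (lead 𝒢 x S)]
    exact add_mem (filt_mono (Nat.le_succ _) (h x)) (lead_mem_filt x S)

/-- Even elements preserve the degree and odd ones raise it by at most one, so the correction for
{y} ∪ t has degree at most |t| + 1. When x = y the exterior product vanishes and y^⟨2⟩ · t has even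
smaller degree. -/
theorem approx_sub_mem (n : ℕ) (x : X) (S : Finset X) (hS : S.card ≤ n) :
    approx q b n S (b x) - lead 𝒢 x S ∈ filt 𝒢 X S.card := by
  induction n generalizing x S with
  | zero =>
    have : S = ∅ := by simpa using hS
    subst this
    rw [approx_of_lt q b _ (by simp), lead_of_lt (by simp), sub_self]
    exact zero_mem _
  | succ n ih =>
    rcases S.eq_empty_or_exists_insert_min with rfl | ⟨y, t, rfl, ht⟩
    · rw [approx_of_lt q b _ (by simp), lead_of_lt (by simp), sub_self]
      exact zero_mem _
    rcases lt_trichotomy x y with hxy | rfl | hxy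
    · have h : ∀ z ∈ insert y t, x < z := by
        intro z hz
        rcases Finset.mem_insert.1 hz with rfl | hz
        exacts [hxy, hxy.trans (ht z hz)]
      rw [approx_of_lt q b _ h, lead_of_lt h, sub_self]
      exact zero_mem _
    · rw [approx_insert_self q b _ ht, lead, if_pos (Finset.mem_insert_self _ _), sub_zero]
      exact even_mem_filt _ (mono_mem_filt (Finset.card_le_card (Finset.subset_insert _ _)))
    · rw [card_insert_min ht] at hS ⊢
      have hc : t.card ≤ n := by lia
      rw [approx_succ_insert q b n ht hxy, add_sub_cancel_left]
      refine sub_mem (even_mem_filt _ (mono_mem_filt (Nat.le_succ _))) (odd_mem ?_ _ (ih x t hc))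
      exact fun S hS v => filt_mono (by lia)
        (mem_filt_of_sub_lead_mem b (fun x => ih x S (hS.trans hc)) v)

theorem approx_succ_eq (n : ℕ) {S : Finset X} (hS : S.card ≤ n) :
    approx q b (n + 1) S = approx q b n S := by
  induction n generalizing S with
  | zero =>
    have : S = ∅ := by simpa using hS
    subst this
    refine b.ext fun x => ?_
    rw [approx_of_lt q b _ (by simp), approx_of_lt q b _ (by simp)]
  | succ n ih =>
    refine b.ext fun x => ?_
    rcases S.eq_empty_or_exists_insert_min with rfl | ⟨y, t, rfl, ht⟩
    · rw [approx_of_lt q b _ (by simp), approx_of_lt q b _ (by simp)]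
    rcases lt_trichotomy x y with hxy | rfl | hxy
    · have h : ∀ z ∈ insert y t, x < z := by
        intro z hz
        rcases Finset.mem_insert.1 hz with rfl | hz
        exacts [hxy, hxy.trans (ht z hz)]
      rw [approx_of_lt q b _ h, approx_of_lt q b _ h]
    · rw [approx_insert_self q b _ ht, approx_insert_self q b _ ht]
    · have hc : t.card ≤ n := by rw [card_insert_min ht] at hS; lia
      rw [approx_succ_insert q b _ ht hxy, approx_succ_insert q b _ ht hxy, ih hc,
        odd_congr (fun S hS => ih (hS.trans hc)) _ (approx_sub_mem q b n x t hc)]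

theorem approx_eq_of_le {n : ℕ} {S : Finset X} (h : S.card ≤ n) :
    approx q b n S = approx q b S.card S := by
  induction n, h using Nat.le_induction with
  | base => rfl
  | succ n hn ih => rw [approx_succ_eq q b n hn, ih]

/-- The action of `g₁` on the free module. -/
def action : 𝒢 1 →ₗ[k] Module.End k (FreeMod 𝒢 X) :=
  odd 𝒢 fun S => approx q b S.card S

theorem action_even (v : 𝒢 1) (a : 𝒢 0) (n : FreeMod 𝒢 X) :
    action q b v (even 𝒢 X a n)
      = even 𝒢 X a (action q b v n) + action q b (oddEven 𝒢 v a) n :=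
  odd_even _ _ _ _ _

theorem action_mono (v : 𝒢 1) (S : Finset X) :
    action q b v (mono 𝒢 S) = approx q b S.card S v :=
  odd_mono _ _ _ _

theorem action_eq_odd {d n : ℕ} (h : d ≤ n) (v : 𝒢 1) {p : FreeMod 𝒢 X} (hp : p ∈ filt 𝒢 X d) :
    action q b v p = odd 𝒢 (approx q b n) v p :=
  odd_congr (fun _ hS => (approx_eq_of_le q b (hS.trans h)).symm) v hp

theorem action_mono_of_lt {x : X} {S : Finset X} (h : ∀ z ∈ S, x < z) :
    action q b (b x) (mono 𝒢 S) = mono 𝒢 (insert x S) := by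
  rw [action_mono, approx_of_lt q b _ h]

theorem action_sub_mem (x : X) (S : Finset X) :
    action q b (b x) (mono 𝒢 S) - lead 𝒢 x S ∈ filt 𝒢 X S.card := by
  rw [action_mono]
  exact approx_sub_mem q b _ x S le_rfl

theorem action_sq_mono_of_lt {y : X} {t : Finset X} (ht : ∀ z ∈ t, y < z) :
    action q b (b y) (action q b (b y) (mono 𝒢 t)) = even 𝒢 X (q.toFun (b y)) (mono 𝒢 t) := by
  rw [action_mono_of_lt q b ht, action_mono, approx_insert_self q b _ ht]

/-- The anticommutation relation built into the recursion. -/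
theorem action_action_mono {x y : X} {t : Finset X} (ht : ∀ z ∈ t, y < z) (hxy : y < x) :
    action q b (b x) (action q b (b y) (mono 𝒢 t)) + action q b (b y) (action q b (b x) (mono 𝒢 t))
      = even 𝒢 X (oddOdd 𝒢 (b x) (b y)) (mono 𝒢 t) := by
  have h3 := action_eq_odd q b le_rfl (b y) (action_sub_mem q b x t)
  -- This is y ∧ (x ∧ t) = - x ∧ (y ∧ t); y acts on x ∧ t as the exterior product because it is
  -- below everything there.
  have h4 : action q b (b y) (lead 𝒢 x t) = -lead 𝒢 x (insert y t) := by
    by_cases hx : x ∈ t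
    · rw [lead, if_pos hx, map_zero, lead, if_pos (Finset.mem_insert_of_mem hx), neg_zero]
    · rw [lead_insert ht hxy hx, lead, if_neg hx, map_smul, action_mono_of_lt, neg_neg]
      intro z hz
      rcases Finset.mem_insert.1 hz with rfl | hz
      exacts [hxy, ht z hz]
  rw [action_mono q b (b x) t] at h3
  rw [action_mono_of_lt q b ht, action_mono, card_insert_min ht, approx_succ_insert q b _ ht hxy,
    action_mono q b (b x) t, ← h3, map_sub, h4]
  abel

/-! ### Verification of the relations between odd elements -/

/-- The relations between the actions of odd elements hold on `n`. -/
def SqOn (n : FreeMod 𝒢 X) : Prop :=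
  ∀ v, action q b v (action q b v n) = even 𝒢 X (q.toFun v) n

variable {q b}

theorem SqOn.add_eq {n : FreeMod 𝒢 X} (h : SqOn q b n) (v w : 𝒢 1) :
    action q b v (action q b w n) + action q b w (action q b v n)
      = even 𝒢 X (oddOdd 𝒢 v w) n := by
  have h1 := h (v + w)
  have h2 := h v
  have h3 := h w
  simp only [q.map_add', map_add, LinearMap.add_apply, h2, h3] at h1
  linear_combination (norm := module) h1

theorem SqOn.zero : SqOn q b 0 := fun v => by simp

theorem SqOn.add {n n' : FreeMod 𝒢 X} (h : SqOn q b n) (h' : SqOn q b n') :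
    SqOn q b (n + n') := fun v => by simp only [map_add, h v, h' v]

theorem SqOn.smul {n : FreeMod 𝒢 X} (c : k) (h : SqOn q b n) :
    SqOn q b (c • n) := fun v => by simp only [map_smul, h v]

/-- Moving v twice past a gives v v a = a v v + [v, a] v + v [v, a]. The last two terms add up to
[v, [v, a]] = [v^⟨2⟩, a], which turns a v^⟨2⟩ into v^⟨2⟩ a. -/
theorem SqOn.even {n : FreeMod 𝒢 X} (a : 𝒢 0) (h : SqOn q b n) :
    SqOn q b (even 𝒢 X a n) := fun v => by
  have h1 := h.add_eq v (oddEven 𝒢 v a)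
  have h2 := even_lie 𝒢 X (q.toFun v) a n
  rw [q.lie_eq] at h2
  rw [action_even, map_add, action_even, h v]
  linear_combination (norm := module) h1 + h2

/-- Both sides are quadratic in v, so squares of basis elements and the polarized identity for pairs
suffice. On the diagonal the polarized identity is twice the square, by [x, x] = 2 x^⟨2⟩. -/
theorem SqOn.of_basis {n : FreeMod 𝒢 X}
    (h : ∀ x, action q b (b x) (action q b (b x) n) = SuperPBW.even 𝒢 X (q.toFun (b x)) n)
    (h' : ∀ x z, z < x → action q b (b x) (action q b (b z) n)
      + action q b (b z) (action q b (b x) n) = SuperPBW.even 𝒢 X (oddOdd 𝒢 (b x) (b z)) n) :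
    SqOn q b n := by
  have key : ∀ v w, action q b v (action q b w n) + action q b w (action q b v n)
      = SuperPBW.even 𝒢 X (oddOdd 𝒢 v w) n := by
    intro v w
    induction v using b.induction_on with
    | zero => simp
    | add v v' hv hv' => simp only [map_add, LinearMap.add_apply, ← hv, ← hv']; abel
    | smul c v hv => simp only [map_smul, LinearMap.smul_apply, ← hv, smul_add]
    | basis x =>
      induction w using b.induction_on with
      | zero => simp
      | add v v' hv hv' => simp only [map_add, LinearMap.add_apply, ← hv, ← hv']; abel
      | smul c v hv => simp only [map_smul, LinearMap.smul_apply, ← hv, smul_add]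
      | basis z =>
        rcases lt_trichotomy x z with hxz | rfl | hxz
        · rw [add_comm, oddOdd_comm, h' z x hxz]
        · rw [q.oddOdd_self, map_smul, LinearMap.smul_apply, h, two_smul]
        · exact h' x z hxz
  intro v
  induction v using b.induction_on with
  -- That 0^⟨2⟩ = 0 comes from the scaling axiom with c = 0.
  | zero =>
    have := q.map_smul 0 0
    simp only [zero_pow two_ne_zero, zero_smul] at this
    simp [this]
  | add v w hv hw =>
    have h1 := key v w
    simp only [q.map_add', map_add, LinearMap.add_apply, hv, hw]
    linear_combination (norm := module) h1
  | smul c v hv =>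
    simp only [q.map_smul, map_smul, LinearMap.smul_apply, hv, smul_smul, pow_two]
  | basis x => exact h x

/-- The set {y} ∪ t is written as y · t; basis elements at least y are moved past y, and the terms
left over are matched by identities in g. -/
theorem sqOn_mono_of_forall {d : ℕ} (ih : ∀ n ∈ filt 𝒢 X d, SqOn q b n) {y : X} {t : Finset X}
    (ht : ∀ z ∈ t, y < z) (hc : t.card ≤ d) : SqOn q b (mono 𝒢 (insert y t)) := by
  have ht' : SqOn q b (mono 𝒢 t) := ih _ (mono_mem_filt hc)
  have e := action_mono_of_lt q b ht
  -- As z · t may have degree above `d`, it is split: the leading term is a multiple of a set lying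
  -- above y, where the relation holds by construction, and the remainder falls under `ih`.
  have key : ∀ x z, y < x → y < z →
      action q b (b x) (action q b (b y) (action q b (b z) (mono 𝒢 t)))
        + action q b (b y) (action q b (b x) (action q b (b z) (mono 𝒢 t)))
      = even 𝒢 X (oddOdd 𝒢 (b x) (b y)) (action q b (b z) (mono 𝒢 t)) := by
    intro x z hx hz
    have h1 := (ih _ (filt_mono hc (action_sub_mem q b z t))).add_eq (b x) (b y)
    have h2 : action q b (b x) (action q b (b y) (lead 𝒢 z t))
        + action q b (b y) (action q b (b x) (lead 𝒢 z t))
        = even 𝒢 X (oddOdd 𝒢 (b x) (b y)) (lead 𝒢 z t) := by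
      refine lead_induction (P := fun n => action q b (b x) (action q b (b y) n)
        + action q b (b y) (action q b (b x) n) = even 𝒢 X (oddOdd 𝒢 (b x) (b y)) n) ht hz
        (by simp) (fun c n hn => ?_) (fun S hS => action_action_mono q b hS hx)
      simp only [map_smul, ← hn, smul_add]
    simp only [map_sub] at h1
    linear_combination (norm := module) h1 + h2
  have key' : ∀ x, y < x → action q b (b y) (action q b (b y) (action q b (b x) (mono 𝒢 t)))
      = even 𝒢 X (q.toFun (b y)) (action q b (b x) (mono 𝒢 t)) := by
    intro x hx
    have h1 := ih _ (filt_mono hc (action_sub_mem q b x t)) (b y)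
    have h2 : action q b (b y) (action q b (b y) (lead 𝒢 x t))
        = even 𝒢 X (q.toFun (b y)) (lead 𝒢 x t) := by
      refine lead_induction (P := fun n => action q b (b y) (action q b (b y) n)
        = even 𝒢 X (q.toFun (b y)) n) ht hx
        (by simp) (fun c n hn => ?_) (fun S hS => action_sq_mono_of_lt q b hS)
      simp only [map_smul, hn]
    simp only [map_sub] at h1
    linear_combination (norm := module) h1 + h2
  refine SqOn.of_basis (fun x => ?_) (fun x z hzx => ?_)
  · rcases lt_trichotomy x y with hxy | rfl | hxy
    · refine action_sq_mono_of_lt q b fun z hz => ?_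
      rcases Finset.mem_insert.1 hz with rfl | hz
      exacts [hxy, hxy.trans (ht z hz)]
    -- Here y y (y t) = y (y^⟨2⟩ t), and y commutes with y^⟨2⟩.
    · rw [← e, ht' (b x), action_even, q.oddEven_self, map_zero, LinearMap.zero_apply, add_zero]
    · have a1 := congrArg (action q b (b x)) (action_action_mono q b ht hxy)
      have a2 := key x x hxy hxy
      have a3 := congrArg (action q b (b y)) (ht' (b x))
      have a4 := congrArg (fun v => action q b v (mono 𝒢 t)) (q.oddEven_eq (b x) (b y))
      simp only [map_add, map_neg, LinearMap.neg_apply, action_even] at a1 a3 a4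
      rw [← e]
      -- Moving y out of x x y t leaves y x^⟨2⟩ t + [x, [x, y]] t, which is x^⟨2⟩ y t because [y,
      -- x^⟨2⟩] = -[x, [x, y]].
      linear_combination (norm := module) a1 - a2 + a3 + a4
  · rcases lt_trichotomy z y with hzy | rfl | hzy
    · refine action_action_mono q b (fun u hu => ?_) hzx
      rcases Finset.mem_insert.1 hu with rfl | hu
      exacts [hzy, hzy.trans (ht u hu)]
    · have a1 := congrArg (action q b (b x)) (ht' (b z))
      have a2 := congrArg (action q b (b z)) (action_action_mono q b ht hzx)
      have a3 := key' x hzx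
      have a4 := congrArg (fun v => action q b v (mono 𝒢 t)) (q.oddEven_eq (b z) (b x))
      rw [oddOdd_comm] at a4
      simp only [map_add, map_neg, LinearMap.neg_apply, action_even] at a1 a2 a4
      rw [← e]
      linear_combination (norm := module) a1 + a2 - a3 + a4
    · have hx := hzy.trans hzx
      have a1 := congrArg (action q b (b x)) (action_action_mono q b ht hzy)
      have a2 := congrArg (action q b (b z)) (action_action_mono q b ht hx)
      have a3 := key x z hx hzy
      have a4 := key z x hzy hx
      have a5 := congrArg (action q b (b y)) (ht'.add_eq (b x) (b z))
      -- For x, y, z distinct, the brackets left after moving y out cancel by the Jacobi identity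
      -- for three odd elements.
      have a6 := congrArg (fun v => action q b v (mono 𝒢 t)) (oddEven_oddOdd (b x) (b y) (b z))
      simp only [map_add, LinearMap.add_apply, map_zero, LinearMap.zero_apply, action_even]
        at a1 a2 a5 a6
      rw [← e]
      linear_combination (norm := module) a1 + a2 - a3 - a4 + a5 + a6

theorem sqOn_of_mem {d : ℕ} {n : FreeMod 𝒢 X} (hn : n ∈ filt 𝒢 X d) : SqOn q b n := by
  induction d generalizing n with
  | zero =>
    refine filt_induction hn SqOn.zero (fun _ _ => SqOn.add) (fun c _ => SqOn.smul c)
      (fun a _ => SqOn.even a) fun S hS => ?_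
    have : S = ∅ := by simpa using hS
    subst this
    exact SqOn.of_basis (fun x => action_sq_mono_of_lt q b (by simp))
      (fun x z h => action_action_mono q b (by simp) h)
  | succ d ih =>
    refine filt_induction hn SqOn.zero (fun _ _ => SqOn.add) (fun c _ => SqOn.smul c)
      (fun a _ => SqOn.even a) fun S hS => ?_
    rcases S.eq_empty_or_exists_insert_min with rfl | ⟨y, t, rfl, ht⟩
    · exact ih (mono_mem_filt (by simp))
    · exact sqOn_mono_of_forall (fun n => ih) ht (by rw [card_insert_min ht] at hS; lia)

variable (q b)

theorem sqOn (n : FreeMod 𝒢 X) : SqOn q b n :=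
  let ⟨_, hd⟩ := mem_filt_of_forall n
  sqOn_of_mem hd

end SuperPBW
end

/-! ### The representation of 𝐔(g) and the basis of ordered monomials -/

noncomputable section
open LieSuperalgebra

theorem ZMod.eq_zero_or_eq_one : ∀ i : ZMod 2, i = 0 ∨ i = 1 := by decide

namespace SuperPBW
open FreeMod

variable {k g : Type*} [CommRing k] [AddCommGroup g] [Module k g]
  {𝒢 : ZMod 2 → Submodule k g} [DirectSum.Decomposition 𝒢]

variable (𝒢) in
/-- The projection to a homogeneous component. -/
def component (i : ZMod 2) : g →ₗ[k] 𝒢 i :=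
  DirectSum.component k (ZMod 2) (fun i => 𝒢 i) i ∘ₗ
    (DirectSum.decomposeLinearEquiv 𝒢).toLinearMap

theorem component_coe (i : ZMod 2) (v : 𝒢 i) : component 𝒢 i (v : g) = v := by
  simp [component]

theorem component_coe_of_ne {i j : ZMod 2} (h : i ≠ j) (v : 𝒢 i) :
    component 𝒢 j (v : g) = 0 := by
  simp [component, DirectSum.component.of, h]

variable [LieSuperalgebra 𝒢] {X : Type*} [LinearOrder X]
  (q : TwoOperation 𝒢) (b : Module.Basis X k (𝒢 1))

/-- The action of `g` on the free `U(g₀)`-module. -/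
def rep : g →ₗ[k] Module.End k (FreeMod 𝒢 X) :=
  even 𝒢 X ∘ₗ component 𝒢 0 + action q b ∘ₗ component 𝒢 1

theorem rep_even (a : 𝒢 0) : rep q b (a : g) = even 𝒢 X a := by
  simp [rep, component_coe, component_coe_of_ne]

theorem rep_odd (v : 𝒢 1) : rep q b (v : g) = action q b v := by
  simp [rep, component_coe, component_coe_of_ne]

/-- Two even elements: the module structure over U(g₀). Mixed parity: the rule `action_even`. Two
odd elements: the polarization of `sqOn`. -/
theorem rep_bracket {i j : ZMod 2} {z w : g} (hz : z ∈ 𝒢 i) (hw : w ∈ 𝒢 j) :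
    rep q b z * rep q b w - (-1 : ℤˣ) ^ (i * j) • (rep q b w * rep q b z)
      - rep q b (bracket 𝒢 z w) = 0 := by
  lift z to 𝒢 i using hz
  lift w to 𝒢 j using hw
  refine LinearMap.ext fun n => ?_
  rcases ZMod.eq_zero_or_eq_one i with rfl | rfl <;>
    rcases ZMod.eq_zero_or_eq_one j with rfl | rfl
  · simp [← coe_lie_even, rep_even, even_lie]
  · simp [bracket_odd_even, ← coe_oddEven, rep_even, rep_odd, action_even]
  · simp [← coe_oddEven, rep_even, rep_odd, action_even]
  · have h := (sqOn q b n).add_eq z w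
    simp [← coe_oddOdd, rep_even, rep_odd, ← h, Units.smul_def]

theorem rep_sq (v : 𝒢 1) : rep q b (v : g) * rep q b (v : g) - rep q b (q.toFun v : g) = 0 := by
  refine LinearMap.ext fun n => ?_
  have h := sqOn q b n v
  simp [rep_even, rep_odd, h]

/-- The action of `𝐔(g)` on the free `U(g₀)`-module. -/
def superAction : SuperEnveloping q →ₐ[k] Module.End k (FreeMod 𝒢 X) :=
  SuperEnveloping.lift q (rep q b) (rep_bracket q b) (rep_sq q b)

theorem superAction_ι (z : g) : superAction q b (SuperEnveloping.ι q z) = rep q b z :=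
  SuperEnveloping.lift_ι q _ _ _ z

theorem evenMap_ι (a : 𝒢 0) :
    evenMap q (UniversalEnvelopingAlgebra.ι k a) = SuperEnveloping.ι q (a : g) :=
  UniversalEnvelopingAlgebra.lift_ι_apply k _ a

theorem superAction_evenMap (r : UniversalEnvelopingAlgebra k (𝒢 0)) (n : FreeMod 𝒢 X) :
    superAction q b (evenMap q r) n = r • n := by
  induction r using UniversalEnvelopingAlgebra.induction_mul with
  | one => simp
  | add u v hu hv => simp [hu, hv, add_smul]
  | smul c u hu => simp [hu]
  | mul x u hu =>
    rw [map_mul, map_mul, Module.End.mul_apply, hu, evenMap_ι, superAction_ι, rep_even, even_apply,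
      mul_smul]

/-- The ordered product in `𝐔(g)` of the members of a finite set of odd basis elements. -/
def oddMonomial (S : Finset X) : SuperEnveloping q :=
  (S.sort.map fun x => SuperEnveloping.ι q (b x : g)).prod

theorem oddMonomial_empty : oddMonomial q b ∅ = 1 := by simp [oddMonomial]

theorem oddMonomial_insert {y : X} {t : Finset X} (ht : ∀ z ∈ t, y < z) :
    oddMonomial q b (insert y t) = SuperEnveloping.ι q (b y : g) * oddMonomial q b t := by
  simp [oddMonomial, sort_insert_min ht]

theorem superAction_oddMonomial (S : Finset X) :
    superAction q b (oddMonomial q b S) (mono 𝒢 ∅) = mono 𝒢 S := by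
  induction h : S.card generalizing S with
  | zero =>
    have : S = ∅ := by simpa using h
    subst this
    simp [oddMonomial_empty]
  | succ n ih =>
    rcases S.eq_empty_or_exists_insert_min with rfl | ⟨y, t, rfl, ht⟩
    · simp at h
    · rw [oddMonomial_insert q b ht, map_mul, Module.End.mul_apply,
        ih t (by rw [card_insert_min ht] at h; lia), superAction_ι, rep_odd,
        action_mono_of_lt q b ht]

/-- The map from the free `U(g₀)`-module to `𝐔(g)` that sends basis elements to ordered products. -/
def ordered : FreeMod 𝒢 X →ₗ[k] SuperEnveloping q :=
  lsum fun S => LinearMap.mulRight k (oddMonomial q b S) ∘ₗ (evenMap q).toLinearMap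

theorem ordered_smul_mono (r : UniversalEnvelopingAlgebra k (𝒢 0)) (S : Finset X) :
    ordered q b (r • mono 𝒢 S) = evenMap q r * oddMonomial q b S := by
  simp [ordered, lsum_smul_mono]

theorem ordered_mono (S : Finset X) : ordered q b (mono 𝒢 S) = oddMonomial q b S := by
  simp [ordered, lsum_mono]

theorem ordered_smul (r : UniversalEnvelopingAlgebra k (𝒢 0)) (n : FreeMod 𝒢 X) :
    ordered q b (r • n) = evenMap q r * ordered q b n := by
  induction n using FreeMod.induction_on with
  | zero => simp
  | add n n' h h' => simp [h, h', mul_add]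
  | smul_mono r' S => rw [smul_smul, ordered_smul_mono, ordered_smul_mono, map_mul, mul_assoc]

theorem ordered_even (a : 𝒢 0) (n : FreeMod 𝒢 X) :
    ordered q b (even 𝒢 X a n) = SuperEnveloping.ι q (a : g) * ordered q b n := by
  rw [even_apply, ordered_smul, evenMap_ι]

theorem ι_odd_mul_ι_even (v : 𝒢 1) (a : 𝒢 0) :
    SuperEnveloping.ι q (v : g) * SuperEnveloping.ι q (a : g)
      = SuperEnveloping.ι q (a : g) * SuperEnveloping.ι q (v : g)
        + SuperEnveloping.ι q (oddEven 𝒢 v a : g) := by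
  have h := SuperEnveloping.ι_mul_ι q v.2 a.2
  rw [mul_zero, uzpow_zero, one_smul, sub_sub, sub_eq_zero] at h
  exact h

theorem ι_odd_mul_ι_odd (v w : 𝒢 1) :
    SuperEnveloping.ι q (v : g) * SuperEnveloping.ι q (w : g)
      = -(SuperEnveloping.ι q (w : g) * SuperEnveloping.ι q (v : g))
        + SuperEnveloping.ι q (oddOdd 𝒢 v w : g) := by
  have h := SuperEnveloping.ι_mul_ι q v.2 w.2
  rw [mul_one, uzpow_one, Units.neg_smul, one_smul, sub_sub, sub_eq_zero] at h
  exact h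

theorem ordered_action_mono_of_lt {x : X} {S : Finset X} (h : ∀ z ∈ S, x < z) :
    ordered q b (action q b (b x) (mono 𝒢 S))
      = SuperEnveloping.ι q (b x : g) * ordered q b (mono 𝒢 S) := by
  rw [action_mono_of_lt q b h, ordered_mono, ordered_mono, oddMonomial_insert q b h]

/-- The rule v a = a v + [v, a] holds both in the module and in 𝐔(g), so intertwining spreads from
the sets S to their U(g₀)-span. -/
theorem ordered_action_of_forall_mono {d : ℕ}
    (h : ∀ S : Finset X, S.card ≤ d → ∀ x, ordered q b (action q b (b x) (mono 𝒢 S))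
      = SuperEnveloping.ι q (b x : g) * ordered q b (mono 𝒢 S))
    {n : FreeMod 𝒢 X} (hn : n ∈ filt 𝒢 X d) (v : 𝒢 1) :
    ordered q b (action q b v n) = SuperEnveloping.ι q (v : g) * ordered q b n := by
  refine filt_induction (P := fun n => ∀ v : 𝒢 1, ordered q b (action q b v n)
    = SuperEnveloping.ι q (v : g) * ordered q b n) hn (fun v => by simp)
    (fun n n' hn hn' v => by simp only [map_add, hn, hn', mul_add])
    (fun c n hn v => by simp only [map_smul, hn, mul_smul_comm])
    (fun a n hn v => ?_) (fun S hS v => ?_) v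
  · rw [action_even, map_add, ordered_even, ordered_even, hn, hn, ← mul_assoc, ← mul_assoc,
      ι_odd_mul_ι_even, add_mul]
  · induction v using b.induction_on with
    | zero => simp
    | add v w hv hw =>
      simp only [map_add, LinearMap.add_apply, hv, hw, Submodule.coe_add, add_mul]
    | smul c v hv =>
      simp only [map_smul, LinearMap.smul_apply, hv, Submodule.coe_smul, smul_mul_assoc]
    | basis x => exact h S hS x

/-- Each branch of the recursion for x · S is an identity in 𝐔(g) once sets are replaced by ordered
products. -/
theorem ordered_action_of_mem {d : ℕ} {n : FreeMod 𝒢 X} (hn : n ∈ filt 𝒢 X d) (v : 𝒢 1) :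
    ordered q b (action q b v n) = SuperEnveloping.ι q (v : g) * ordered q b n := by
  induction d generalizing v n with
  | zero =>
    refine ordered_action_of_forall_mono q b (fun S hS x => ?_) hn v
    have : S = ∅ := by simpa using hS
    subst this
    exact ordered_action_mono_of_lt q b (by simp)
  | succ d ih =>
    refine ordered_action_of_forall_mono q b (fun S hS x => ?_) hn v
    rcases S.eq_empty_or_exists_insert_min with rfl | ⟨y, t, rfl, ht⟩
    · exact ordered_action_mono_of_lt q b (by simp)
    have hc : t.card ≤ d := by rw [card_insert_min ht] at hS; lia
    have ht' : mono 𝒢 t ∈ filt 𝒢 X d := mono_mem_filt hc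
    have e := action_mono_of_lt q b ht
    rcases lt_trichotomy x y with hxy | rfl | hxy
    · refine ordered_action_mono_of_lt q b fun z hz => ?_
      rcases Finset.mem_insert.1 hz with rfl | hz
      exacts [hxy, hxy.trans (ht z hz)]
    · have h := SuperEnveloping.ι_sq q (b x)
      rw [sub_eq_zero] at h
      rw [← e, action_sq_mono_of_lt q b ht, ordered_even, ordered_action_mono_of_lt q b ht,
        ← mul_assoc, h]
    -- Again the leading term of x · t is handled separately, the induction hypothesis covering only
    -- the remainder.
    · have h1 : ordered q b (action q b (b y) (action q b (b x) (mono 𝒢 t)))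
          = SuperEnveloping.ι q (b y : g) * ordered q b (action q b (b x) (mono 𝒢 t)) := by
        have h2 := ih (filt_mono hc (action_sub_mem q b x t)) (b y)
        have h3 : ordered q b (action q b (b y) (lead 𝒢 x t))
            = SuperEnveloping.ι q (b y : g) * ordered q b (lead 𝒢 x t) :=
          lead_induction (P := fun n => ordered q b (action q b (b y) n)
            = SuperEnveloping.ι q (b y : g) * ordered q b n) ht hxy (by simp)
            (fun c n hn => by simp only [map_smul, hn, mul_smul_comm])
            (fun S hS => ordered_action_mono_of_lt q b hS)
        simp only [map_sub, mul_sub] at h2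
        linear_combination (norm := noncomm_ring) h2 + h3
      rw [← e, eq_sub_of_add_eq (action_action_mono q b ht hxy), map_sub, ordered_even, h1,
        ih ht', ordered_action_mono_of_lt q b ht, ← mul_assoc, ← mul_assoc, ι_odd_mul_ι_odd q (b x)]
      noncomm_ring

theorem ordered_rep (z : g) (n : FreeMod 𝒢 X) :
    ordered q b (rep q b z n) = SuperEnveloping.ι q z * ordered q b n := by
  induction z using DirectSum.Decomposition.inductionOn 𝒢 with
  | zero => simp
  | @homogeneous i m =>
    rcases ZMod.eq_zero_or_eq_one i with rfl | rfl
    · rw [rep_even, ordered_even]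
    · obtain ⟨d, hd⟩ := mem_filt_of_forall n
      rw [rep_odd, ordered_action_of_mem q b hd]
  | add z w hz hw => simp [hz, hw, add_mul]

theorem _root_.SuperEnveloping.induction_mul {P : SuperEnveloping q → Prop} (u : SuperEnveloping q)
    (one : P 1) (add : ∀ u v, P u → P v → P (u + v)) (smul : ∀ (c : k) u, P u → P (c • u))
    (mul : ∀ (z : g) u, P u → P (SuperEnveloping.ι q z * u)) : P u := by
  obtain ⟨t, rfl⟩ : ∃ t, SuperEnveloping.mk q t = u := RingQuot.mkAlgHom_surjective k _ u
  suffices h : ∀ u, P u → P (SuperEnveloping.mk q t * u) by simpa using h 1 one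
  induction t using TensorAlgebra.induction with
  | algebraMap r =>
    intro u hu
    rw [AlgHom.commutes, ← Algebra.smul_def]
    exact smul r u hu
  | ι x => exact mul x
  | mul a c ha hc =>
    intro u hu
    rw [map_mul, mul_assoc]
    exact ha _ (hc _ hu)
  | add a c ha hc =>
    intro u hu
    rw [map_add, add_mul]
    exact add _ _ (ha _ hu) (hc _ hu)

/-- Taking for `n` the empty set shows that every u is the image of u · ∅. -/
theorem ordered_superAction (u : SuperEnveloping q) (n : FreeMod 𝒢 X) :
    ordered q b (superAction q b u n) = u * ordered q b n := by
  induction u using SuperEnveloping.induction_mul with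
  | one => simp
  | add u v hu hv => simp [hu, hv, add_mul]
  | smul c u hu => simp [hu]
  | mul x u hu =>
    rw [map_mul, Module.End.mul_apply, superAction_ι, ordered_rep, hu, mul_assoc]

/-- The free left `U(g₀)`-module on the finite sets of odd basis elements is isomorphic to
`𝐔(g)`. -/
def orderedEquiv : FreeMod 𝒢 X ≃ₗ[k] SuperEnveloping q :=
  { ordered q b with
    invFun := fun u => superAction q b u (mono 𝒢 ∅)
    left_inv := fun n => by
      change superAction q b (ordered q b n) (mono 𝒢 ∅) = n
      induction n using FreeMod.induction_on with
      | zero => simp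
      | add n n' h h' => rw [map_add, map_add, LinearMap.add_apply, h, h']
      | smul_mono r S =>
        rw [ordered_smul_mono, map_mul, Module.End.mul_apply, superAction_oddMonomial,
          superAction_evenMap]
    right_inv := fun u => by
      change ordered q b (superAction q b u (mono 𝒢 ∅)) = u
      rw [ordered_superAction, ordered_mono, oddMonomial_empty, mul_one] }

theorem orderedEquiv_smul_mono (r : UniversalEnvelopingAlgebra k (𝒢 0)) (S : Finset X) :
    orderedEquiv q b (r • mono 𝒢 S) = evenMap q r * oddMonomial q b S :=
  ordered_smul_mono q b r S

/-- The concatenation of the blocks a, …, a (r a times), for a increasing, is a sorted list of the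
multiset, and sorted lists are unique. -/
theorem sort_toMultiset_map_prod {Y A : Type*} [LinearOrder Y] [Monoid A] (f : Y → A)
    (r : Y →₀ ℕ) :
    ((Finsupp.toMultiset r).sort.map f).prod = (r.support.sort.map fun a => f a ^ r a).prod := by
  have h : (Finsupp.toMultiset r).sort = r.support.sort.flatMap fun a => List.replicate (r a) a := by
    refine List.Perm.eq_of_pairwise' (r := (· ≤ ·)) (Multiset.pairwise_sort _ _) ?_ ?_
    · rw [List.pairwise_flatMap]
      refine ⟨fun a _ => by simp [List.pairwise_replicate], ?_⟩
      refine (Finset.pairwise_sort r.support (· ≤ ·)).imp fun {a c} hac x hx y hy => ?_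
      rw [List.eq_of_mem_replicate hx, List.eq_of_mem_replicate hy]
      exact hac
    · rw [← Multiset.coe_eq_coe, Multiset.sort_eq, ← Multiset.coe_bind, Finset.sort_eq]
      rw [Finsupp.toMultiset_apply, Finsupp.sum, Finset.sum, Multiset.bind, Multiset.join]
      simp only [Multiset.nsmul_singleton, Multiset.coe_replicate]
  rw [h, List.map_flatMap, List.flatMap, List.prod_flatten, List.map_map]
  congr 2
  funext a
  simp

/-- The basis of `𝐔(g)` formed by the ordered monomials. -/
def superBasis {X₀ : Type*} [LinearOrder X₀] (b₀ : Module.Basis X₀ k (𝒢 0)) :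
    Module.Basis ((X₀ →₀ ℕ) × Finset X) k (SuperEnveloping q) :=
  (((Finsupp.basis fun _ : Finset X => PBW.basis b₀).reindex
      ((Equiv.sigmaEquivProd _ _).trans
        ((Equiv.prodComm _ _).trans
          (Equiv.prodCongr Multiset.toFinsupp.toEquiv (Equiv.refl _))))).map
    (show (Finset X →₀ UniversalEnvelopingAlgebra k (𝒢 0)) ≃ₗ[k] SuperEnveloping q from
      orderedEquiv q b))

theorem superBasis_apply {X₀ : Type*} [LinearOrder X₀] (b₀ : Module.Basis X₀ k (𝒢 0))
    (r : X₀ →₀ ℕ) (S : Finset X) : superBasis q b b₀ (r, S) = superMonomial q b₀ b r S := by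
  have h : superBasis q b b₀ (r, S)
      = orderedEquiv q b (PBW.basis b₀ (Finsupp.toMultiset r) • mono 𝒢 S) := by
    rw [smul_mono_eq_single]
    have e : superBasis q b b₀ (r, S) = orderedEquiv q b
        ((Finsupp.basis fun _ : Finset X => PBW.basis b₀) ⟨S, Finsupp.toMultiset r⟩) := by
      rw [superBasis, Module.Basis.map_apply, Module.Basis.reindex_apply]
      rfl
    rw [e, Finsupp.coe_basis]
  rw [h, orderedEquiv_smul_mono, PBW.basis_apply, PBW.monomial, sort_toMultiset_map_prod,
    map_list_prod, List.map_map, superMonomial, oddMonomial]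
  congr 3
  funext a
  rw [Function.comp_apply, map_pow, evenMap_ι]

end SuperPBW
end

/-! ### Sign rules in super tensor products and the basis of the exterior algebra -/

noncomputable section
open LieSuperalgebra

namespace GradedTensorProduct

variable {k A B : Type*} [CommRing k] [Ring A] [Algebra k A] [Ring B] [Algebra k B]
  (𝒜 : ZMod 2 → Submodule k A) (ℬ : ZMod 2 → Submodule k B) [GradedAlgebra 𝒜] [GradedAlgebra ℬ]

/-- An even element passes anything without a sign, so `x` need not be homogeneous. -/
theorem tmul_mul_tmul_of_mem_zero (a x : A) {c : B} (hc : c ∈ ℬ 0) (y : B) :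
    (a ᵍ⊗ₜ[k] c * x ᵍ⊗ₜ[k] y : 𝒜 ᵍ⊗[k] ℬ) = (a * x) ᵍ⊗ₜ[k] (c * y) := by
  induction x using DirectSum.Decomposition.inductionOn 𝒜 with
  | zero => simp [tmul]
  | homogeneous x => exact tmul_zero_coe_mul_coe_tmul 𝒜 ℬ a ⟨c, hc⟩ x y
  | add x x' h h' =>
    simp only [tmul, TensorProduct.add_tmul, map_add, mul_add] at h h' ⊢
    rw [h, h']

theorem one_tmul_mul_tmul {i j : ZMod 2} {x : A} (hx : x ∈ 𝒜 i) {c : B} (hc : c ∈ ℬ j) (y : B) :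
    ((1 : A) ᵍ⊗ₜ[k] c * x ᵍ⊗ₜ[k] y : 𝒜 ᵍ⊗[k] ℬ)
      = (-1 : ℤˣ) ^ (j * i) • (x ᵍ⊗ₜ[k] (c * y)) := by
  rw [tmul_coe_mul_coe_tmul 𝒜 ℬ 1 ⟨c, hc⟩ ⟨x, hx⟩ y, one_mul]

end GradedTensorProduct

namespace ExteriorAlgebra

variable {k V X : Type*} [CommRing k] [AddCommGroup V] [Module k V] [LinearOrder X]
  (b : Module.Basis X k V)

theorem basis_eq_prod_sort (S : Finset X) :
    b.ExteriorAlgebra S = (S.sort.map fun x => ι k (b x)).prod := by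
  rw [basis_apply_ofCard b (s := S) rfl, ιMulti_family, ιMulti_apply]
  congr 1
  refine List.ext_getElem (by simp) fun n h1 h2 => ?_
  simp [Finset.orderEmbOfFin_apply, Set.powersetCard.ofFinEmbEquiv]

theorem basis_empty : b.ExteriorAlgebra ∅ = 1 := by
  simp [basis_eq_prod_sort]

theorem basis_insert {y : X} {t : Finset X} (ht : ∀ z ∈ t, y < z) :
    b.ExteriorAlgebra (insert y t) = ι k (b y) * b.ExteriorAlgebra t := by
  simp [basis_eq_prod_sort, SuperPBW.sort_insert_min ht]

theorem basis_mem_grading (S : Finset X) :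
    b.ExteriorAlgebra S ∈ exteriorGrading k V (S.card : ZMod 2) := by
  induction h : S.card generalizing S with
  | zero =>
    rw [Finset.card_eq_zero.1 h, basis_empty, Nat.cast_zero]
    exact SetLike.GradedOne.one_mem
  | succ n ih =>
    rcases S.eq_empty_or_exists_insert_min with rfl | ⟨y, t, rfl, ht⟩
    · simp at h
    · rw [basis_insert b ht, Nat.cast_succ, add_comm]
      exact SetLike.GradedMul.mul_mem (CliffordAlgebra.ι_mem_evenOdd_one _ _)
        (ih t (by rw [SuperPBW.card_insert_min ht] at h; lia))

open GradedTensorProduct in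
-- Its counterpart in 𝐔(g) is `SuperPBW.primitive_odd_mul`; the two expansions carry the same sign,
-- which is why comultiplications can be compared term by term.
theorem primitive_mul (v : V) {i : ZMod 2} {w : ExteriorAlgebra k V}
    (hw : w ∈ exteriorGrading k V i) (w' : ExteriorAlgebra k V) :
    exteriorPrimitive k V v * w ᵍ⊗ₜ[k] w'
      = of k _ _ ((ExteriorAlgebra.ι k v * w) ⊗ₜ[k] w'
        + (-1 : ℤˣ) ^ i • (w ⊗ₜ[k] (ExteriorAlgebra.ι k v * w'))) := by
  have e1 := tmul_mul_tmul_of_mem_zero (exteriorGrading k V) (exteriorGrading k V)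
    (ExteriorAlgebra.ι k v) w (SetLike.GradedOne.one_mem) w'
  have e2 := one_tmul_mul_tmul (exteriorGrading k V) (exteriorGrading k V)
    hw (CliffordAlgebra.ι_mem_evenOdd_one _ v) w'
  have e : exteriorPrimitive k V v
      = ExteriorAlgebra.ι k v ᵍ⊗ₜ[k] 1 + 1 ᵍ⊗ₜ[k] ExteriorAlgebra.ι k v := rfl
  rw [one_mul] at e1 e2
  rw [e, add_mul, e1]
  exact congrArg _ e2

end ExteriorAlgebra

/-! ### The isomorphism with U(g₀) ⊗ ⋀ g₁ and its super-coalgebra structure -/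

namespace SuperPBW
open FreeMod

variable {k g : Type*} [CommRing k] [AddCommGroup g] [Module k g]
  {𝒢 : ZMod 2 → Submodule k g} [DirectSum.Decomposition 𝒢] [LieSuperalgebra 𝒢]
  {X : Type*} [LinearOrder X] (q : TwoOperation 𝒢) (b : Module.Basis X k (𝒢 1))

/-- The linear map `⋀ g₁ → 𝐔(g)` that sends an ordered product of basis elements to the same
product. -/
def exteriorMap : ExteriorAlgebra k (𝒢 1) →ₗ[k] SuperEnveloping q :=
  b.ExteriorAlgebra.constr k (oddMonomial q b)

theorem exteriorMap_basis (S : Finset X) :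
    exteriorMap q b (b.ExteriorAlgebra S) = oddMonomial q b S :=
  Module.Basis.constr_basis _ _ _ _

theorem exteriorMap_one : exteriorMap q b 1 = 1 := by
  rw [← ExteriorAlgebra.basis_empty b, exteriorMap_basis, oddMonomial_empty]

/-- The map is compatible with a left multiplication only when the product stays increasing; this is
the only multiplicativity used. -/
theorem exteriorMap_ι_mul {y : X} {t : Finset X} (ht : ∀ z ∈ t, y < z) :
    exteriorMap q b (ExteriorAlgebra.ι k (b y) * b.ExteriorAlgebra t)
      = SuperEnveloping.ι q (b y : g) * exteriorMap q b (b.ExteriorAlgebra t) := by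
  rw [← ExteriorAlgebra.basis_insert b ht, exteriorMap_basis, exteriorMap_basis,
    oddMonomial_insert q b ht]

theorem oddMonomial_mem_grading (S : Finset X) :
    oddMonomial q b S ∈ SuperEnveloping.grading q (S.card : ZMod 2) := by
  induction h : S.card generalizing S with
  | zero =>
    rw [Finset.card_eq_zero.1 h, oddMonomial_empty, Nat.cast_zero]
    exact SetLike.GradedOne.one_mem
  | succ n ih =>
    rcases S.eq_empty_or_exists_insert_min with rfl | ⟨y, t, rfl, ht⟩
    · simp at h
    · rw [oddMonomial_insert q b ht, Nat.cast_succ, add_comm]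
      exact SetLike.GradedMul.mul_mem (SuperEnveloping.ι_mem_grading q (b y).2)
        (ih t (by rw [card_insert_min ht] at h; lia))

theorem exteriorMap_component (i : ZMod 2) (w : ExteriorAlgebra k (𝒢 1)) :
    exteriorMap q b (component (exteriorGrading k (𝒢 1)) i w)
      = component (SuperEnveloping.grading q) i (exteriorMap q b w) := by
  induction w using b.ExteriorAlgebra.induction_on with
  | zero => simp
  | add w w' h h' => simp [h, h']
  | smul c w h => simp [h]
  | basis S =>
    have h1 := ExteriorAlgebra.basis_mem_grading b S
    have h2 := oddMonomial_mem_grading q b S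
    rw [exteriorMap_basis]
    by_cases h : (S.card : ZMod 2) = i
    · subst h
      rw [component_coe _ ⟨_, h1⟩, component_coe _ ⟨_, h2⟩]
      exact exteriorMap_basis q b S
    · rw [component_coe_of_ne h ⟨_, h1⟩, component_coe_of_ne h ⟨_, h2⟩]
      simp

theorem exteriorMap_mem {i : ZMod 2} {w : ExteriorAlgebra k (𝒢 1)}
    (hw : w ∈ exteriorGrading k (𝒢 1) i) : exteriorMap q b w ∈ SuperEnveloping.grading q i := by
  have h := exteriorMap_component q b i w
  rw [component_coe _ ⟨w, hw⟩] at h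
  change exteriorMap q b w = _ at h
  rw [h]
  exact Subtype.prop _

theorem evenMap_mem (r : UniversalEnvelopingAlgebra k (𝒢 0)) :
    evenMap q r ∈ SuperEnveloping.grading q 0 := by
  induction r using UniversalEnvelopingAlgebra.induction_mul with
  | one => rw [map_one]; exact SetLike.GradedOne.one_mem
  | add u v hu hv => rw [map_add]; exact add_mem hu hv
  | smul c u hu => rw [map_smul]; exact Submodule.smul_mem _ _ hu
  | mul x u hu =>
    rw [map_mul, evenMap_ι]
    simpa using SetLike.GradedMul.mul_mem (SuperEnveloping.ι_mem_grading q x.2) hu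

/-- The isomorphism `U(g₀) ⊗ ⋀ g₁ ≃ 𝐔(g)`. -/
def tensorEquiv :
    UniversalEnvelopingAlgebra k (𝒢 0) ⊗[k] ExteriorAlgebra k (𝒢 1) ≃ₗ[k] SuperEnveloping q :=
  ((Algebra.TensorProduct.basis (UniversalEnvelopingAlgebra k (𝒢 0))
    b.ExteriorAlgebra).repr.restrictScalars k).trans
    (show (Finset X →₀ UniversalEnvelopingAlgebra k (𝒢 0)) ≃ₗ[k] SuperEnveloping q from
      orderedEquiv q b)

theorem tensorEquiv_tmul (r : UniversalEnvelopingAlgebra k (𝒢 0)) (w : ExteriorAlgebra k (𝒢 1)) :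
    tensorEquiv q b (r ⊗ₜ w) = evenMap q r * exteriorMap q b w := by
  induction w using b.ExteriorAlgebra.induction_on with
  | zero => simp
  | add w w' h h' => simp only [TensorProduct.tmul_add, map_add, mul_add, h, h']
  | smul c w h => simp only [TensorProduct.tmul_smul, map_smul, mul_smul_comm, h]
  | basis S =>
    rw [exteriorMap_basis, ← orderedEquiv_smul_mono, smul_mono_eq_single]
    refine congrArg (orderedEquiv q b) ?_
    refine (Algebra.TensorProduct.basis_repr_tmul _ _ _).trans ?_
    rw [Module.Basis.repr_self, Finsupp.mapRange_single, map_one, Finsupp.smul_single, smul_eq_mul,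
      mul_one]

theorem tensorEquiv_smul (a : UniversalEnvelopingAlgebra k (𝒢 0))
    (t : UniversalEnvelopingAlgebra k (𝒢 0) ⊗[k] ExteriorAlgebra k (𝒢 1)) :
    tensorEquiv q b (a • t) = evenMap q a * tensorEquiv q b t := by
  induction t using TensorProduct.induction_on with
  | zero => simp
  | add t t' h h' => simp only [smul_add, map_add, mul_add, h, h']
  | tmul r w =>
    rw [TensorProduct.smul_tmul', tensorEquiv_tmul, tensorEquiv_tmul, smul_eq_mul, map_mul,
      mul_assoc]

theorem tensorEquiv_mem {i : ZMod 2}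
    {t : UniversalEnvelopingAlgebra k (𝒢 0) ⊗[k] ExteriorAlgebra k (𝒢 1)}
    (ht : t ∈ tensorGrading (pureEven k (UniversalEnvelopingAlgebra k (𝒢 0)))
      (exteriorGrading k (𝒢 1)) i) :
    tensorEquiv q b t ∈ SuperEnveloping.grading q i := by
  suffices h : tensorGrading (pureEven k (UniversalEnvelopingAlgebra k (𝒢 0)))
      (exteriorGrading k (𝒢 1)) i
      ≤ (SuperEnveloping.grading q i).comap (tensorEquiv q b).toLinearMap from h ht
  refine iSup_le fun j => iSup_le fun l => iSup_le fun hjl => ?_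
  rintro _ ⟨t, rfl⟩
  induction t using TensorProduct.induction_on with
  | zero => simp
  | add t t' h h' => rw [map_add]; exact add_mem h h'
  | tmul r w =>
    obtain ⟨r, hr⟩ := r
    by_cases hj : j = 0
    · subst hj
      simp only [TensorProduct.mapIncl, TensorProduct.map_tmul, Submodule.mem_comap,
        LinearEquiv.coe_coe, tensorEquiv_tmul, Submodule.subtype_apply]
      rw [← hjl]
      exact SetLike.GradedMul.mul_mem (evenMap_mem q r) (exteriorMap_mem q b w.2)
    · have : r = 0 := by simpa [pureEven, hj] using hr
      subst this
      simp [TensorProduct.mapIncl]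

theorem exists_add_eq_of_tensorGrading
    (t : UniversalEnvelopingAlgebra k (𝒢 0) ⊗[k] ExteriorAlgebra k (𝒢 1)) :
    ∃ t₀ ∈ tensorGrading (pureEven k (UniversalEnvelopingAlgebra k (𝒢 0)))
      (exteriorGrading k (𝒢 1)) 0,
    ∃ t₁ ∈ tensorGrading (pureEven k (UniversalEnvelopingAlgebra k (𝒢 0)))
      (exteriorGrading k (𝒢 1)) 1, t = t₀ + t₁ := by
  induction t using TensorProduct.induction_on with
  | zero => exact ⟨0, zero_mem _, 0, zero_mem _, (add_zero _).symm⟩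
  | add t t' h h' =>
    obtain ⟨t₀, h₀, t₁, h₁, rfl⟩ := h
    obtain ⟨t₀', h₀', t₁', h₁', rfl⟩ := h'
    exact ⟨_, add_mem h₀ h₀', _, add_mem h₁ h₁', add_add_add_comm _ _ _ _⟩
  | tmul r w =>
    have key : ∀ (i : ZMod 2) (w : exteriorGrading k (𝒢 1) i), r ⊗ₜ[k] (w : ExteriorAlgebra k (𝒢 1))
        ∈ tensorGrading (pureEven k (UniversalEnvelopingAlgebra k (𝒢 0)))
          (exteriorGrading k (𝒢 1)) i := by
      intro i w
      refine Submodule.mem_iSup_of_mem 0 (Submodule.mem_iSup_of_mem i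
        (Submodule.mem_iSup_of_mem (zero_add i) ?_))
      exact ⟨⟨r, by simp [pureEven]⟩ ⊗ₜ w, rfl⟩
    refine ⟨_, key 0 (component _ 0 w), _, key 1 (component _ 1 w), ?_⟩
    rw [← TensorProduct.tmul_add]
    congr 1
    induction w using DirectSum.Decomposition.inductionOn (exteriorGrading k (𝒢 1)) with
    | zero => simp
    | add w w' h h' =>
      nth_rewrite 1 [h, h']
      simp only [map_add, Submodule.coe_add]
      abel
    | @homogeneous i w =>
      rcases ZMod.eq_zero_or_eq_one i with rfl | rfl <;>
        simp [component_coe, component_coe_of_ne]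

/-- The map preserves degrees, the even and odd parts span the source, and the sum of degrees is
direct in the target; hence each degree is hit exactly. -/
theorem map_tensorGrading (i : ZMod 2) :
    (tensorGrading (pureEven k (UniversalEnvelopingAlgebra k (𝒢 0)))
      (exteriorGrading k (𝒢 1)) i).map (tensorEquiv q b).toLinearMap
      = SuperEnveloping.grading q i := by
  refine le_antisymm (Submodule.map_le_iff_le_comap.2 fun t => tensorEquiv_mem q b) fun u hu => ?_
  obtain ⟨t, rfl⟩ := (tensorEquiv q b).surjective u
  obtain ⟨t₀, h₀, t₁, h₁, rfl⟩ := exists_add_eq_of_tensorGrading t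
  have e₀ := tensorEquiv_mem q b h₀
  have e₁ := tensorEquiv_mem q b h₁
  -- The image of t₀ + t₁ equals its own component of degree i, which is the image of tᵢ alone.
  have hc := congrArg Subtype.val (component_coe (𝒢 := SuperEnveloping.grading q) i ⟨_, hu⟩)
  simp only [map_add] at hc
  rcases ZMod.eq_zero_or_eq_one i with rfl | rfl
  · rw [component_coe _ ⟨_, e₀⟩, component_coe_of_ne one_ne_zero ⟨_, e₁⟩, add_zero] at hc
    exact ⟨t₀, h₀, hc.trans (map_add _ _ _).symm⟩
  · rw [component_coe _ ⟨_, e₁⟩, component_coe_of_ne zero_ne_one ⟨_, e₀⟩, zero_add] at hc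
    exact ⟨t₁, h₁, hc.trans (map_add _ _ _).symm⟩

theorem counit_evenMap (r : UniversalEnvelopingAlgebra k (𝒢 0)) :
    SuperEnveloping.counit q (evenMap q r) = envelopingCounit k (𝒢 0) r := by
  induction r using UniversalEnvelopingAlgebra.induction_mul with
  | one => simp
  | add u v hu hv => simp only [map_add, hu, hv]
  | smul c u hu => simp only [map_smul, hu]
  | mul x u hu =>
    have h1 : SuperEnveloping.counit q (SuperEnveloping.ι q (x : g)) = 0 :=
      SuperEnveloping.lift_ι q 0 (fun _ _ => by simp) (fun _ => by simp) _
    have h2 : envelopingCounit k (𝒢 0) (UniversalEnvelopingAlgebra.ι k x) = 0 :=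
      UniversalEnvelopingAlgebra.lift_ι_apply k _ _
    rw [map_mul, map_mul, map_mul, evenMap_ι, h1, h2, zero_mul, zero_mul]

theorem counit_exteriorMap (w : ExteriorAlgebra k (𝒢 1)) :
    SuperEnveloping.counit q (exteriorMap q b w) = exteriorCounit k (𝒢 1) w := by
  induction w using b.ExteriorAlgebra.induction_on with
  | zero => simp
  | add w w' h h' => simp only [map_add, h, h']
  | smul c w h => simp only [map_smul, h]
  | basis S =>
    rw [exteriorMap_basis]
    rcases S.eq_empty_or_exists_insert_min with rfl | ⟨y, t, rfl, ht⟩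
    · rw [oddMonomial_empty, ExteriorAlgebra.basis_empty, map_one, map_one]
    · have h1 : SuperEnveloping.counit q (SuperEnveloping.ι q (b y : g)) = 0 :=
        SuperEnveloping.lift_ι q 0 (fun _ _ => by simp) (fun _ => by simp) _
      have h2 : exteriorCounit k (𝒢 1) (ExteriorAlgebra.ι k (b y)) = 0 :=
        ExteriorAlgebra.lift_ι_apply k _ _ _
      rw [oddMonomial_insert q b ht, ExteriorAlgebra.basis_insert b ht, map_mul, map_mul, h1, h2,
        zero_mul, zero_mul]

theorem counit_comp_tensorEquiv :
    (SuperEnveloping.counit q).toLinearMap ∘ₗ (tensorEquiv q b).toLinearMap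
      = tensorCounit (envelopingCounit k (𝒢 0)).toLinearMap
          (exteriorCounit k (𝒢 1)).toLinearMap := by
  refine TensorProduct.ext' fun r w => ?_
  simp only [LinearMap.comp_apply, LinearEquiv.coe_coe, tensorEquiv_tmul, AlgHom.toLinearMap_apply,
    map_mul, counit_evenMap, counit_exteriorMap, tensorCounit, TensorProduct.map_tmul,
    LinearMap.mul'_apply]

theorem superInterchange_tmul {A E : Type*} [AddCommGroup A] [Module k A] [AddCommGroup E]
    [Module k E] (ℰ : ZMod 2 → Submodule k E) [DirectSum.Decomposition ℰ] (a a' : A) (w w' : E) :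
    superInterchange (pureEven k A) ℰ ((a ⊗ₜ a') ⊗ₜ (w ⊗ₜ w')) = (a ⊗ₜ w) ⊗ₜ (a' ⊗ₜ w') := by
  have h : superSymmetry (pureEven k A) ℰ (a' ⊗ₜ w) = w ⊗ₜ a' := by
    induction w using DirectSum.Decomposition.inductionOn ℰ with
    | zero => simp
    | add w w' h h' => simp only [TensorProduct.tmul_add, map_add, h, h', TensorProduct.add_tmul]
    | @homogeneous i w =>
      rw [superSymmetry_tmul (i := 0) _ _ (by simp [pureEven]) w.2, mul_zero, uzpow_zero, one_smul]
  simp [superInterchange, h]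

/-- The map induced on tensor squares by the canonical map `U(g₀) → 𝐔(g)`. -/
abbrev evenMapSq : UniversalEnvelopingAlgebra k (𝒢 0) ⊗[k] UniversalEnvelopingAlgebra k (𝒢 0) →ₗ[k]
    SuperEnveloping q ⊗[k] SuperEnveloping q :=
  TensorProduct.map (evenMap q).toLinearMap (evenMap q).toLinearMap

/-- The map induced on tensor squares by the map `⋀ g₁ → 𝐔(g)`. -/
abbrev exteriorMapSq : ExteriorAlgebra k (𝒢 1) ⊗[k] ExteriorAlgebra k (𝒢 1) →ₗ[k]
    SuperEnveloping q ⊗[k] SuperEnveloping q :=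
  TensorProduct.map (exteriorMap q b) (exteriorMap q b)

open GradedTensorProduct in
-- Elements of g₀ are primitive on both sides, and being even they multiply tensors without signs.
theorem comulAlgHom_evenMap (r : UniversalEnvelopingAlgebra k (𝒢 0)) :
    SuperEnveloping.comulAlgHom q (evenMap q r)
      = of k (SuperEnveloping.grading q) (SuperEnveloping.grading q)
          (evenMapSq q (envelopingComul k (𝒢 0) r)) := by
  induction r using UniversalEnvelopingAlgebra.induction_mul with
  | one =>
    rw [map_one, map_one, map_one, Algebra.TensorProduct.one_def, TensorProduct.map_tmul,
      AlgHom.toLinearMap_apply, map_one]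
    rfl
  | add u v hu hv => simp only [map_add, hu, hv]
  | smul c u hu => simp only [map_smul, hu]
  | mul x u hu =>
    have h1 : SuperEnveloping.comulAlgHom q (SuperEnveloping.ι q (x : g))
        = SuperEnveloping.ι q (x : g) ᵍ⊗ₜ[k] 1 + 1 ᵍ⊗ₜ[k] SuperEnveloping.ι q (x : g) :=
      SuperEnveloping.lift_ι q _ _ _ _
    have h2 : envelopingComul k (𝒢 0) (UniversalEnvelopingAlgebra.ι k x)
        = UniversalEnvelopingAlgebra.ι k x ⊗ₜ 1 + 1 ⊗ₜ UniversalEnvelopingAlgebra.ι k x :=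
      UniversalEnvelopingAlgebra.lift_ι_apply k _ _
    rw [map_mul, map_mul, map_mul, hu, evenMap_ι, h1, h2]
    generalize envelopingComul k (𝒢 0) u = t
    induction t using TensorProduct.induction_on with
    | zero => simp
    | add t t' h h' => simp only [mul_add, map_add, h, h']
    | tmul r r' =>
      have e1 := tmul_mul_tmul_of_mem_zero (SuperEnveloping.grading q) (SuperEnveloping.grading q)
        (SuperEnveloping.ι q (x : g)) (evenMap q r) (SetLike.GradedOne.one_mem) (evenMap q r')
      have e2 := tmul_mul_tmul_of_mem_zero (SuperEnveloping.grading q) (SuperEnveloping.grading q)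
        1 (evenMap q r) (SuperEnveloping.ι_mem_grading q x.2) (evenMap q r')
      simp only [TensorProduct.map_tmul, AlgHom.toLinearMap_apply, add_mul, e1, e2,
        Algebra.TensorProduct.tmul_mul_tmul, map_add, map_mul, evenMap_ι, one_mul]

/-- The span in `⋀ g₁ ⊗ ⋀ g₁` of the tensors of basis elements given by subsets of `S`. -/
def subsetSpan (S : Finset X) : Submodule k (ExteriorAlgebra k (𝒢 1) ⊗[k] ExteriorAlgebra k (𝒢 1)) :=
  Submodule.span k {t | ∃ u u' : Finset X, u ⊆ S ∧ u' ⊆ S ∧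
    b.ExteriorAlgebra u ⊗ₜ[k] b.ExteriorAlgebra u' = t}

open GradedTensorProduct in
theorem primitive_odd_mul (v : 𝒢 1) {i : ZMod 2} {w : SuperEnveloping q}
    (hw : w ∈ SuperEnveloping.grading q i) (w' : SuperEnveloping q) :
    SuperEnveloping.primitive q (v : g) * w ᵍ⊗ₜ[k] w'
      = of k _ _ ((SuperEnveloping.ι q (v : g) * w) ⊗ₜ[k] w'
        + (-1 : ℤˣ) ^ i • (w ⊗ₜ[k] (SuperEnveloping.ι q (v : g) * w'))) := by
  have e1 := tmul_mul_tmul_of_mem_zero (SuperEnveloping.grading q) (SuperEnveloping.grading q)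
    (SuperEnveloping.ι q (v : g)) w (SetLike.GradedOne.one_mem) w'
  have e2 := one_tmul_mul_tmul (SuperEnveloping.grading q) (SuperEnveloping.grading q)
    hw (SuperEnveloping.ι_mem_grading q v.2) w'
  have e : SuperEnveloping.primitive q (v : g)
      = SuperEnveloping.ι q (v : g) ᵍ⊗ₜ[k] 1 + 1 ᵍ⊗ₜ[k] SuperEnveloping.ι q (v : g) := rfl
  rw [one_mul] at e1 e2
  rw [e, add_mul, e1]
  exact congrArg _ e2

open GradedTensorProduct in
-- Multiplying b_u ⊗ b_u' by Δ(y) puts y in front of one factor. Since u and u' lie above y, the new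
-- products are still increasing, so the map to 𝐔(g) commutes with this operation and the support
-- stays within subsets of {y} ∪ S.
theorem exteriorPrimitive_mul_mem {y : X} {S : Finset X} (hS : ∀ z ∈ S, y < z)
    {t : ExteriorAlgebra k (𝒢 1) ⊗[k] ExteriorAlgebra k (𝒢 1)} (ht : t ∈ subsetSpan b S) :
    (of k _ _).symm (exteriorPrimitive k (𝒢 1) (b y) * of k _ _ t) ∈ subsetSpan b (insert y S) ∧
    SuperEnveloping.primitive q (b y : g) * of k _ _ (exteriorMapSq q b t)
      = of k _ _ (exteriorMapSq q b
          ((of k _ _).symm (exteriorPrimitive k (𝒢 1) (b y) * of k _ _ t))) := by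
  induction ht using Submodule.span_induction with
  | zero => simp
  | add t t' _ _ h h' =>
    simp only [map_add, mul_add]
    exact ⟨add_mem h.1 h'.1, by rw [h.2, h'.2]⟩
  | smul c t _ h =>
    simp only [map_smul, mul_smul_comm]
    exact ⟨Submodule.smul_mem _ _ h.1, by rw [h.2]⟩
  | mem t ht =>
    obtain ⟨u, u', hu, hu', rfl⟩ := ht
    have hyu : ∀ z ∈ u, y < z := fun z hz => hS z (hu hz)
    have hyu' : ∀ z ∈ u', y < z := fun z hz => hS z (hu' hz)
    have h1 := ExteriorAlgebra.primitive_mul (b y) (ExteriorAlgebra.basis_mem_grading b u)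
      (b.ExteriorAlgebra u')
    have h2 := primitive_odd_mul q (b y) (exteriorMap_mem q b (ExteriorAlgebra.basis_mem_grading b u))
      (exteriorMap q b (b.ExteriorAlgebra u'))
    rw [h1, of_symm_of]
    constructor
    · rw [← ExteriorAlgebra.basis_insert b hyu, ← ExteriorAlgebra.basis_insert b hyu',
        Units.smul_def]
      have s : ∀ v : Finset X, v ⊆ S → v ⊆ insert y S :=
        fun v hv => hv.trans (Finset.subset_insert _ _)
      refine add_mem (Submodule.subset_span ?_) (zsmul_mem (Submodule.subset_span ?_) _)
      · exact ⟨_, _, Finset.insert_subset_insert _ hu, s _ hu', rfl⟩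
      · exact ⟨_, _, s _ hu, Finset.insert_subset_insert _ hu', rfl⟩
    · rw [TensorProduct.map_tmul, h2, Units.smul_def, Units.smul_def, map_add (exteriorMapSq q b),
        map_zsmul, TensorProduct.map_tmul, TensorProduct.map_tmul, exteriorMap_ι_mul q b hyu,
        exteriorMap_ι_mul q b hyu']

open GradedTensorProduct in
-- The support condition is carried through the induction because the next, smaller factor y may be
-- multiplied in only if all tensors present involve elements above y.
theorem comulAlgHom_oddMonomial (S : Finset X) :
    (of k _ _).symm (exteriorComulAlgHom k (𝒢 1) (b.ExteriorAlgebra S)) ∈ subsetSpan b S ∧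
    SuperEnveloping.comulAlgHom q (oddMonomial q b S)
      = of k _ _ (exteriorMapSq q b (exteriorComul k (𝒢 1) (b.ExteriorAlgebra S))) := by
  induction h : S.card generalizing S with
  | zero =>
    rw [Finset.card_eq_zero.1 h, oddMonomial_empty, ExteriorAlgebra.basis_empty, map_one]
    constructor
    · refine Submodule.subset_span ⟨∅, ∅, subset_rfl, subset_rfl, ?_⟩
      rw [ExteriorAlgebra.basis_empty]
      rfl
    · have e : exteriorComul k (𝒢 1) 1 = 1 ⊗ₜ 1 := by
        rw [exteriorComul, LinearMap.comp_apply, AlgHom.toLinearMap_apply, map_one]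
        rfl
      rw [map_one, e, TensorProduct.map_tmul, exteriorMap_one]
      rfl
  | succ n ih =>
    rcases S.eq_empty_or_exists_insert_min with rfl | ⟨y, t, rfl, ht⟩
    · simp at h
    · obtain ⟨i1, i2⟩ := ih t (by rw [card_insert_min ht] at h; lia)
      have h1 : exteriorComulAlgHom k (𝒢 1) (ExteriorAlgebra.ι k (b y))
          = exteriorPrimitive k (𝒢 1) (b y) := ExteriorAlgebra.lift_ι_apply k _ _ _
      have h2 : SuperEnveloping.comulAlgHom q (SuperEnveloping.ι q (b y : g))
          = SuperEnveloping.primitive q (b y : g) := SuperEnveloping.lift_ι q _ _ _ _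
      have h3 := exteriorPrimitive_mul_mem q b ht i1
      rw [symm_of_of] at h3
      have e1 : exteriorComulAlgHom k (𝒢 1) (b.ExteriorAlgebra (insert y t))
          = exteriorPrimitive k (𝒢 1) (b y) * exteriorComulAlgHom k (𝒢 1) (b.ExteriorAlgebra t) := by
        rw [ExteriorAlgebra.basis_insert b ht, map_mul, h1]
      have e2 : SuperEnveloping.comulAlgHom q (oddMonomial q b (insert y t))
          = SuperEnveloping.primitive q (b y : g)
            * SuperEnveloping.comulAlgHom q (oddMonomial q b t) := by
        rw [oddMonomial_insert q b ht, map_mul, h2]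
      rw [e2, i2, exteriorComul, LinearMap.comp_apply, LinearMap.comp_apply,
        AlgHom.toLinearMap_apply, AlgHom.toLinearMap_apply, e1]
      exact h3

open GradedTensorProduct in
theorem comulAlgHom_exteriorMap (w : ExteriorAlgebra k (𝒢 1)) :
    SuperEnveloping.comulAlgHom q (exteriorMap q b w)
      = of k _ _ (exteriorMapSq q b (exteriorComul k (𝒢 1) w)) := by
  induction w using b.ExteriorAlgebra.induction_on with
  | zero => simp
  | add w w' h h' => simp only [map_add, h, h']
  | smul c w h => simp only [map_smul, h]
  | basis S => rw [exteriorMap_basis, (comulAlgHom_oddMonomial q b S).2]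

open GradedTensorProduct in
-- The product of Δ(r) and Δ(w) matches the interchange of tensor factors; neither produces a sign,
-- because U(g₀) is purely even.
theorem of_evenMapSq_mul_of_exteriorMapSq
    (s : UniversalEnvelopingAlgebra k (𝒢 0) ⊗[k] UniversalEnvelopingAlgebra k (𝒢 0))
    (t : ExteriorAlgebra k (𝒢 1) ⊗[k] ExteriorAlgebra k (𝒢 1)) :
    of k (SuperEnveloping.grading q) (SuperEnveloping.grading q) (evenMapSq q s)
        * of k _ _ (exteriorMapSq q b t)
      = of k _ _ (TensorProduct.map (tensorEquiv q b).toLinearMap (tensorEquiv q b).toLinearMap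
          (superInterchange (pureEven k (UniversalEnvelopingAlgebra k (𝒢 0)))
            (exteriorGrading k (𝒢 1)) (s ⊗ₜ t))) := by
  induction s using TensorProduct.induction_on with
  | zero => simp
  | add s s' h h' => simp only [map_add, add_mul, TensorProduct.add_tmul, h, h']
  | tmul r r' =>
    induction t using TensorProduct.induction_on with
    | zero => simp
    | add t t' h h' => simp only [map_add, mul_add, TensorProduct.tmul_add, h, h']
    | tmul w w' =>
      rw [superInterchange_tmul, TensorProduct.map_tmul, TensorProduct.map_tmul,
        TensorProduct.map_tmul, LinearEquiv.coe_coe, tensorEquiv_tmul, tensorEquiv_tmul]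
      exact tmul_mul_tmul_of_mem_zero _ _ _ _ (evenMap_mem q r') _

theorem comul_comp_tensorEquiv :
    SuperEnveloping.comul q ∘ₗ (tensorEquiv q b).toLinearMap
      = TensorProduct.map (tensorEquiv q b).toLinearMap (tensorEquiv q b).toLinearMap ∘ₗ
          tensorComul (pureEven k (UniversalEnvelopingAlgebra k (𝒢 0))) (exteriorGrading k (𝒢 1))
            (envelopingComul k (𝒢 0)).toLinearMap (exteriorComul k (𝒢 1)) := by
  refine TensorProduct.ext' fun r w => ?_
  rw [LinearMap.comp_apply, LinearEquiv.coe_coe, tensorEquiv_tmul, SuperEnveloping.comul,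
    LinearMap.comp_apply, AlgHom.toLinearMap_apply, map_mul, comulAlgHom_evenMap,
    comulAlgHom_exteriorMap, of_evenMapSq_mul_of_exteriorMapSq]
  rfl

end SuperPBW

theorem corollaryA {k g : Type*} [CommRing k] [AddCommGroup g] [Module k g]
    (𝒢 : ZMod 2 → Submodule k g) [DirectSum.Decomposition 𝒢] [LieSuperalgebra 𝒢]
    (q : LieSuperalgebra.TwoOperation 𝒢) :
    (∀ {X₀ X₁ : Type*} [LinearOrder X₀] [LinearOrder X₁]
      (b₀ : Module.Basis X₀ k (𝒢 0)) (b₁ : Module.Basis X₁ k (𝒢 1)),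
      ∃ B : Module.Basis ((X₀ →₀ ℕ) × Finset X₁) k (SuperEnveloping q),
        ∀ r s, B (r, s) = superMonomial q b₀ b₁ r s) ∧
    (Module.Finite k (𝒢 0) → Module.Projective k (𝒢 0) → Module.Free k (𝒢 1) →
      ∃ φ : UniversalEnvelopingAlgebra k (𝒢 0) ⊗[k] ExteriorAlgebra k (𝒢 1)
          ≃ₗ[k] SuperEnveloping q,
        -- unit-preserving
        φ (1 ⊗ₜ 1) = 1 ∧
        -- left `U(g₀)`-linear
        (∀ (a : UniversalEnvelopingAlgebra k (𝒢 0))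
          (t : UniversalEnvelopingAlgebra k (𝒢 0) ⊗[k] ExteriorAlgebra k (𝒢 1)),
          φ (a • t) = evenMap q a * φ t) ∧
        -- an isomorphism of supermodules
        (∀ i : ZMod 2,
          (tensorGrading (pureEven k (UniversalEnvelopingAlgebra k (𝒢 0)))
            (exteriorGrading k (𝒢 1)) i).map φ.toLinearMap = SuperEnveloping.grading q i) ∧
        -- compatible with the comultiplications
        SuperEnveloping.comul q ∘ₗ φ.toLinearMap =
          TensorProduct.map φ.toLinearMap φ.toLinearMap ∘ₗ
            tensorComul (pureEven k (UniversalEnvelopingAlgebra k (𝒢 0)))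
              (exteriorGrading k (𝒢 1))
              (envelopingComul k (𝒢 0)).toLinearMap (exteriorComul k (𝒢 1)) ∧
        -- compatible with the counits
        (SuperEnveloping.counit q).toLinearMap ∘ₗ φ.toLinearMap =
          tensorCounit (envelopingCounit k (𝒢 0)).toLinearMap
            (exteriorCounit k (𝒢 1)).toLinearMap) := by
  refine ⟨fun b₀ b₁ => ⟨SuperPBW.superBasis q b₁ b₀, SuperPBW.superBasis_apply q b₁ b₀⟩,
    fun _ _ _ => ?_⟩
  classical
  -- The construction needs some total order on the index set of a basis of g₁; any will do, here a
  -- well-order.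
  let _ : LinearOrder (Module.Free.ChooseBasisIndex k (𝒢 1)) :=
    linearOrderOfSTO WellOrderingRel
  have b := Module.Free.chooseBasis k (𝒢 1)
  refine ⟨SuperPBW.tensorEquiv q b, ?_, SuperPBW.tensorEquiv_smul q b,
    SuperPBW.map_tensorGrading q b, SuperPBW.comul_comp_tensorEquiv q b,
    SuperPBW.counit_comp_tensorEquiv q b⟩
  rw [SuperPBW.tensorEquiv_tmul, map_one, SuperPBW.exteriorMap_one, one_mul]

end
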